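/- Let $G,M,m,\gamma_0,\gamma>0$ with $16\gamma>\gamma_0$, put $\mu=(2M+m)/m$ and, for $|\theta|<\pi/2$, $$V(\theta)=GM\sqrt{\tfrac M2}\Big(\frac{M}{\cos\theta}+\frac{4m}{\sqrt{\cos^2\theta+\mu\sin^2\theta}}\Big),\qquad W(\theta)=\frac{GM^2}{2}\Big(\frac{M\gamma_0}{\cos^2\theta}+\frac{8m\gamma}{\cos^2\theta+\mu\sin^2\theta}\Big),\qquad U(\theta)=W(\theta)\cos^2\theta .$$ For $h,C\in\mathbb R$ consider the regularized equations of the spatial isosceles three-body problem with Manev interaction (energy $h$, angular momentum $C$), $$r'=\frac{\cos^2\theta}{\sqrt{U}}\,rv,\qquad v'=r(2hr+V)\frac{\cos^2\theta}{\sqrt{U}},\qquad \theta'=w,$$ $$w'=\frac{\cos\theta}{U}\Big(rV'\cos^3\theta+U'\cos\theta-(C^2-2U)\sin\theta\Big)-\Big(2\tan\theta+\frac{U'}{2U}\Big)w^2,$$ for $(r,v,\theta,w)\in\mathbb R\times\mathbb R\times(-\frac\pi2,\frac\pi2)\times\mathbb R$ (the physical part being $r\ge 0$), and the energy level $\mathcal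 E=\{F=0\}$, where $$F=2hr^2\cos^4\theta-w^2U-v^2\cos^4\theta-C^2\cos^2\theta+2rV\cos^4\theta+2U\cos^2\theta .$$ The triple collision manifold is $\mathcal E\cap\{r=0\}$. Proposition. For every $h\in\mathbb R$ and every $C$ with $|C|\in[0,\sqrt{2U(0)})$, let $P_\pm=(0,\pm\sqrt{2U(0)-C^2},0,0)$. The set $\mathcal E$ is invariant, $P_\pm$ are equilibria lying on the triple collision manifold, and near $P_\pm$ the level $\mathcal E$ is a smooth 3-dimensional manifold with tangent space $T_{P_\pm}\mathcal E=\ker dF(P_\pm)$. The linearization of the system at $P_\pm$ maps $T_{P_\pm}\mathcal E$ to itself, and its restriction $\bar J$ to this space has a positive (for $P_+$), respectively negative (for $P_-$), real eigenvalue and a pair of nonzero purely imaginary eigenvalues (three simple eigenvalues). Within $\mathcal E$, the point $P_+$ (resp. $P_-$) has a one-dimensional smooth local unstable (resp. stable) manifold, i.e. in arbitrarily small neighbourhoods $N$ of the point the set of initial points of orbits that stay in $\mathcal E\cap N$ for all $t\le 0$ (resp. $t\ge0$) and converge to the point as $t\to-\infty$ (resp. $t\to+\infty$) is a smooth curve through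 it; this curve is tangent to the unstable (resp. stable) subspace of $\bar J$, which is transverse to $\{r=0\}$. Moreover $P_+$ and $P_-$ each have, within $\mathcal E$, a two-dimensional smooth local centre manifold, i.e. a locally invariant smooth surface through the point, tangent there to the centre subspace of $\bar J$; it can be taken inside $\{r\ge 0\}$. The stable subspace of $\bar J$ at $P_+$ and the unstable subspace of $\bar J$ at $P_-$ are zero. -/

import Mathlib

open Set Filter Topology
open scoped ContDiff

noncomputable section

/-! ## Invariant manifolds of an autonomous differential equation `x' = X x` -/

section Dynamics

variable {E : Type*} [NormedAddCommGroup E] [NormedSpace ℝ E]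

/-- `S` is an embedded smooth submanifold of `E` of dimension `k` (without boundary): near each of
its points some smooth change of coordinates of `E` flattens `S` to a `k`-dimensional subspace. -/
def IsSmoothSubmanifold (k : ℕ) (S : Set E) : Prop :=
  ∀ x ∈ S, ∃ (φ : OpenPartialHomeomorph E E) (L : Submodule ℝ E),
    x ∈ φ.source ∧ Module.finrank ℝ L = k ∧
    ContDiffOn ℝ ∞ φ φ.source ∧ ContDiffOn ℝ ∞ φ.symm φ.target ∧
    ∀ y ∈ φ.source, (y ∈ S ↔ φ y ∈ L)

/-- The vectors tangent to `S` at `x`: velocities at `x` of curves that lie in `S`. -/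
def tangentVectors (S : Set E) (x : E) : Set E :=
  {e | ∃ c : ℝ → E, c 0 = x ∧ (∀ᶠ t in 𝓝 0, c t ∈ S) ∧ HasDerivAt c e 0}

/-- `S` is invariant relative to `N`: a solution that runs in `N` and meets `S` at time `0`
stays in `S`. -/
def IsLocallyInvariant (X : E → E) (N S : Set E) : Prop :=
  ∀ (γ : ℝ → E) (a b : ℝ), a < 0 → 0 < b →
    IsIntegralCurveOn γ (fun _ => X) (Ioo a b) → (∀ t ∈ Ioo a b, γ t ∈ N) →
    γ 0 ∈ S → ∀ t ∈ Ioo a b, γ t ∈ S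

/-- The local unstable set of `P` in `N`, within the invariant set `S`: the initial points of
backward solutions which stay in `S ∩ N` and tend to `P` as `t → -∞`. -/
def localUnstableSet (X : E → E) (S N : Set E) (P : E) : Set E :=
  {x | ∃ γ : ℝ → E, γ 0 = x ∧ IsIntegralCurveOn γ (fun _ => X) (Iic 0) ∧
    (∀ t ≤ 0, γ t ∈ S ∩ N) ∧ Tendsto γ atBot (𝓝 P)}

/-- The local stable set of `P` in `N`, within the invariant set `S`: the initial points of
forward solutions which stay in `S ∩ N` and tend to `P` as `t → +∞`. -/
def localStableSet (X : E → E) (S N : Set E) (P : E) : Set E :=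
  {x | ∃ γ : ℝ → E, γ 0 = x ∧ IsIntegralCurveOn γ (fun _ => X) (Ici 0) ∧
    (∀ t, 0 ≤ t → γ t ∈ S ∩ N) ∧ Tendsto γ atTop (𝓝 P)}

/-- Within `S`, the equilibrium `P` has a (local) unstable manifold of dimension `k`, tangent at
`P` to the `k`-dimensional subspace `Eu`: in arbitrarily small neighbourhoods of `P` the local
unstable set is such a submanifold. -/
def HasUnstableManifold (X : E → E) (S : Set E) (P : E) (k : ℕ) (Eu : Submodule ℝ E) : Prop :=
  Module.finrank ℝ Eu = k ∧
  ∀ O ∈ 𝓝 P, ∃ N : Set E, IsOpen N ∧ P ∈ N ∧ N ⊆ O ∧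
    P ∈ localUnstableSet X S N P ∧
    IsSmoothSubmanifold k (localUnstableSet X S N P) ∧
    tangentVectors (localUnstableSet X S N P) P = Eu

/-- Within `S`, the equilibrium `P` has a (local) stable manifold of dimension `k`, tangent at
`P` to the `k`-dimensional subspace `Es`. -/
def HasStableManifold (X : E → E) (S : Set E) (P : E) (k : ℕ) (Es : Submodule ℝ E) : Prop :=
  Module.finrank ℝ Es = k ∧
  ∀ O ∈ 𝓝 P, ∃ N : Set E, IsOpen N ∧ P ∈ N ∧ N ⊆ O ∧
    P ∈ localStableSet X S N P ∧
    IsSmoothSubmanifold k (localStableSet X S N P) ∧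
    tangentVectors (localStableSet X S N P) P = Es

/-- Within `S`, the equilibrium `P` has a (local) centre manifold of dimension `k`, tangent at `P`
to the `k`-dimensional subspace `Ec`; `D` is the domain of the vector field. -/
def HasCentreManifold (X : E → E) (D S : Set E) (P : E) (k : ℕ) (Ec : Submodule ℝ E) : Prop :=
  Module.finrank ℝ Ec = k ∧
  ∃ N M : Set E, IsOpen N ∧ P ∈ N ∧ N ⊆ D ∧ P ∈ M ∧ M ⊆ S ∩ N ∧
    IsSmoothSubmanifold k M ∧ tangentVectors M P = Ec ∧ IsLocallyInvariant X N M

end Dynamics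

section Spectral

variable {T : Type*} [AddCommGroup T] [Module ℝ T]

/-- The sum of the real generalized eigenspaces of `A` for the complex eigenvalues in `Z`.
For `z = a + i b` the real generalized eigenspace, which belongs to the pair `z`, `conj z`, is the
space of vectors killed by a power of `(A - z) (A - conj z) = A ^ 2 - 2 a A + |z| ^ 2`. -/
def spectralSubspace (A : Module.End ℝ T) (Z : Set ℂ) : Submodule ℝ T :=
  ⨆ z ∈ Z, ⨆ n : ℕ,
    LinearMap.ker ((A ^ 2 - (2 * z.re) • A + (Complex.normSq z) • (1 : Module.End ℝ T)) ^ n)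

/-- The unstable subspace of `A`: eigenvalues with positive real part. -/
def unstableSubspace (A : Module.End ℝ T) : Submodule ℝ T := spectralSubspace A {z | 0 < z.re}

/-- The stable subspace of `A`: eigenvalues with negative real part. -/
def stableSubspace (A : Module.End ℝ T) : Submodule ℝ T := spectralSubspace A {z | z.re < 0}

/-- The centre subspace of `A`: eigenvalues on the imaginary axis. -/
def centreSubspace (A : Module.End ℝ T) : Submodule ℝ T := spectralSubspace A {z | z.re = 0}

end Spectral

/-! ## The regularized isosceles three-body problem with Manev interaction -/

namespace Manev

/-- The gravitational constant `G`, the masses `M` (twice) and `m`, and the Manev coefficients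
`γ₀` (between the equal masses) and `γ`. -/
structure Params where
  G : ℝ
  M : ℝ
  m : ℝ
  γ₀ : ℝ
  γ : ℝ

/-- Points `(r, v, θ, w)`. -/
abbrev Phase : Type := ℝ × ℝ × ℝ × ℝ

/-- The domain `|θ| < π / 2` of the regularized vector field. As the field is regular at `r = 0`,
`r` runs over `ℝ`; the physical part is `0 ≤ r`. -/
def domain : Set Phase := {x | x.2.2.1 ∈ Ioo (-(Real.pi / 2)) (Real.pi / 2)}

/-- The physical part `0 ≤ r` of the phase space. -/
def physical : Set Phase := {x | 0 ≤ x.1}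

namespace Params

variable (p : Params)

/-- The mass ratio `μ = (2 M + m) / m`. -/
def μ : ℝ := (2 * p.M + p.m) / p.m

/-- The Newtonian part `V(θ)` of the potential. -/
def V (θ : ℝ) : ℝ :=
  p.G * p.M * √(p.M / 2) *
    (p.M / Real.cos θ + 4 * p.m / √(Real.cos θ ^ 2 + p.μ * Real.sin θ ^ 2))

/-- The Manev part `W(θ)` of the potential. -/
def W (θ : ℝ) : ℝ :=
  p.G * p.M * (p.M / 2) *
    (p.M * p.γ₀ / Real.cos θ ^ 2 + 8 * p.m * p.γ / (Real.cos θ ^ 2 + p.μ * Real.sin θ ^ 2))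

/-- `U(θ) = W(θ) cos² θ`. -/
def U (θ : ℝ) : ℝ := p.W θ * Real.cos θ ^ 2

/-- The regularized vector field at energy `h` and angular momentum `C`. In `w'`, the term
quadratic in `w` comes from differentiating the factor `cos² θ / √U(θ)` in
`w = (cos² θ / √U(θ)) u`. -/
def field (h C : ℝ) : Phase → Phase := fun (r, v, θ, w) =>
  (Real.cos θ ^ 2 / √(p.U θ) * r * v,
   r * (2 * h * r + p.V θ) * (Real.cos θ ^ 2 / √(p.U θ)),
   w,
   Real.cos θ / p.U θ *
      (r * deriv p.V θ * Real.cos θ ^ 3 + deriv p.U θ * Real.cos θ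
        - (C ^ 2 - 2 * p.U θ) * Real.sin θ)
    - (2 * Real.tan θ + deriv p.U θ / (2 * p.U θ)) * w ^ 2)

/-- The function whose zero set is the energy level. -/
def F (h C : ℝ) : Phase → ℝ := fun (r, v, θ, w) =>
  2 * h * r ^ 2 * Real.cos θ ^ 4 - w ^ 2 * p.U θ - v ^ 2 * Real.cos θ ^ 4
    - C ^ 2 * Real.cos θ ^ 2 + 2 * r * p.V θ * Real.cos θ ^ 4
    + 2 * p.U θ * Real.cos θ ^ 2

/-- The energy level. -/
def energyLevel (h C : ℝ) : Set Phase := {x ∈ domain | p.F h C x = 0}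

/-- The triple collision manifold, as embedded in the energy level (for `|θ| < π / 2`):
the points of the energy level with `r = 0`. It does not depend on `h`. -/
def collisionManifold (C : ℝ) : Set Phase :=
  {x ∈ domain | x.1 = 0 ∧
    x.2.2.2 ^ 2 + x.2.1 ^ 2 * (Real.cos x.2.2.1 ^ 4 / p.U x.2.2.1)
      + (C ^ 2 - 2 * p.U x.2.2.1) * (Real.cos x.2.2.1 ^ 2 / p.U x.2.2.1) = 0}

/-- The equilibrium `P₊`. -/
def Pplus (C : ℝ) : Phase := (0, √(2 * p.U 0 - C ^ 2), 0, 0)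

/-- The equilibrium `P₋`. -/
def Pminus (C : ℝ) : Phase := (0, -√(2 * p.U 0 - C ^ 2), 0, 0)

/-- The tangent space at `P` of the energy level, the kernel of the differential of `F`. -/
def tangentSpace (h C : ℝ) (P : Phase) : Submodule ℝ Phase :=
  LinearMap.ker (fderiv ℝ (p.F h C) P : Phase →ₗ[ℝ] ℝ)

/-- The linearization of the regularized vector field at `P`. -/
def linearization (h C : ℝ) (P : Phase) : Module.End ℝ Phase :=
  (fderiv ℝ (p.field h C) P : Phase →ₗ[ℝ] Phase)

/-- The energy level is invariant, it is a smooth three-dimensional manifold near `P` with tangent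
space the kernel of `dF`, and `P` is an equilibrium that lies in it on the collision manifold. -/
def IsRegularCollisionEquilibrium (h C : ℝ) (P : Phase) : Prop :=
  IsLocallyInvariant (p.field h C) domain (p.energyLevel h C) ∧
  P ∈ p.energyLevel h C ∧ P ∈ p.collisionManifold C ∧ p.field h C P = 0 ∧
  (∃ N : Set Phase, IsOpen N ∧ P ∈ N ∧ IsSmoothSubmanifold 3 (p.energyLevel h C ∩ N)) ∧
  Module.finrank ℝ (p.tangentSpace h C P) = 3 ∧
  tangentVectors (p.energyLevel h C) P = p.tangentSpace h C P

end Params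

end Manev

end

/-!
The quotient `F / cos⁴ θ` is a first integral of the regularized field, since `F' = -4 w tan θ F`
along solutions; hence the energy level is invariant. It also serves as a coordinate: where `v` has
a fixed sign, `(r, F / cos⁴ θ, θ, w)` is a smooth chart, because the first integral is
`speedSq (r, θ, w) - v ^ 2` and can be solved for `v`. In this chart every invariant manifold of the
theorem near `P±` is a piece of a coordinate subspace, so that no general invariant manifold theorem
is needed; smoothness and tangent spaces are read off from the chart
(`isSmoothSubmanifold_of_chart`, `tangentVectors_of_chart`).

* Since `r' = a r` with a continuous coefficient `a`, the set `r = 0` is invariant. The triple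
  collision manifold near `P±` is therefore a centre manifold, and it lies in `r ≥ 0`
  (`Positive.hasCentreManifold`).
* The potentials are even in `θ`, so `θ = w = 0` is invariant. The homothetic orbits in it can be
  integrated in closed form (`homotheticCurve`), and they sweep out the unstable curve of `P₊`.
* No other backward orbit tends to `P₊`. The quantity
  `K = w² U / cos⁴ θ + (2 U(0) - C²) - (2 U - C²) / cos² θ` has a nondegenerate minimum, of value
  `0`, at `θ = w = 0`; this is where `γ₀ < 16 γ` enters. By the first integral `K' = 2 r V' w`, so
  `K' ≤ B |r| K`, while `r` decays exponentially as `t → -∞`. A Gronwall argument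
  (`nonpos_of_tendsto_atBot`) gives `K = 0`.
* The statements about stable sets at `P₋` follow by the time reversal
  `(r, v, θ, w) ↦ (r, -v, θ, -w)`.

In the coordinates `(r, θ, w)` on the tangent space the linearization is
`(r, θ, w) ↦ (l r, w, -b² θ)` with `l = v / √U(0)` at `P±`, from which its characteristic polynomial
and its spectral subspaces are computed.
-/

/-! ### Submanifolds and tangent vectors in a flattening chart -/

section Geometry

variable {E : Type*} [NormedAddCommGroup E] [NormedSpace ℝ E]

theorem isSmoothSubmanifold_of_chart (φ : OpenPartialHomeomorph E E) (L : Submodule ℝ E) {k : ℕ}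
    (hk : Module.finrank ℝ L = k) (hφ : ContDiffOn ℝ ∞ φ φ.source)
    (hφ' : ContDiffOn ℝ ∞ φ.symm φ.target) {S N : Set E} (hN : IsOpen N) (hSφ : S ⊆ φ.source)
    (hSN : S ⊆ N) (h : ∀ y ∈ φ.source, y ∈ N → (y ∈ S ↔ φ y ∈ L)) :
    IsSmoothSubmanifold k S := fun _ hx =>
  ⟨φ.restrOpen N hN, L, ⟨hSφ hx, hSN hx⟩, hk, hφ.mono inter_subset_left,
    hφ'.mono fun _ hy => hy.1, fun y hy => h y hy.1 hy.2⟩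

theorem tangentVectors_of_chart [FiniteDimensional ℝ E] (φ : OpenPartialHomeomorph E E)
    (L : Submodule ℝ E)
    (hφ' : ContDiffOn ℝ ∞ φ.symm φ.target) {S N : Set E} {P : E} (hN : IsOpen N) (hPN : P ∈ N)
    (hPφ : P ∈ φ.source) (hPS : P ∈ S) (h : ∀ y ∈ φ.source, y ∈ N → (y ∈ S ↔ φ y ∈ L))
    {D : E →L[ℝ] E} (hD : HasFDerivAt φ D P) :
    tangentVectors S P = {e | D e ∈ L} := by
  have hev : ∀ᶠ y in 𝓝 P, y ∈ φ.source ∧ y ∈ N :=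
    Filter.inter_mem (φ.open_source.mem_nhds hPφ) (hN.mem_nhds hPN)
  have hPL : φ P ∈ L := (h P hPφ hPN).1 hPS
  ext e
  constructor
  · rintro ⟨c, rfl, hcS, hc⟩
    have hd : HasDerivAt (fun t => φ (c t)) (D e) 0 := hD.comp_hasDerivAt 0 hc
    have hmem : ∀ᶠ t in 𝓝 (0 : ℝ), φ (c t) ∈ L := by
      filter_upwards [hcS, hc.continuousAt.eventually hev] with t h1 h2
      exact (h _ h2.1 h2.2).1 h1
    have hcl : IsClosed (L : Set E) := L.closed_of_finiteDimensional
    have hs := hasDerivAt_iff_tendsto_slope.1 hd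
    refine hcl.mem_of_tendsto hs ?_
    filter_upwards [nhdsWithin_le_nhds hmem] with t ht
    rw [slope_def_module]
    exact L.smul_mem _ (L.sub_mem ht hPL)
  · intro he
    have hsy : HasFDerivAt φ.symm (fderiv ℝ φ.symm (φ P)) (φ P) :=
      ((hφ'.contDiffAt (φ.open_target.mem_nhds (φ.map_source hPφ))).differentiableAt
        (by simp)).hasFDerivAt
    have hinv : (fderiv ℝ φ.symm (φ P)) (D e) = e := by
      have h1 : HasFDerivAt (fun x => φ.symm (φ x)) ((fderiv ℝ φ.symm (φ P)).comp D) P :=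
        hsy.comp P hD
      have h2 : HasFDerivAt (fun x => φ.symm (φ x)) (ContinuousLinearMap.id ℝ E) P :=
        (hasFDerivAt_id P).congr_of_eventuallyEq
          (by filter_upwards [hev] with y hy using φ.left_inv hy.1)
      simpa using congrArg (fun T : E →L[ℝ] E => T e) (h1.unique h2)
    have hl : HasDerivAt (fun t : ℝ => φ P + t • D e) (D e) 0 := by
      simpa using ((hasDerivAt_id (0 : ℝ)).smul_const (D e)).const_add (φ P)
    have hl0 : φ P + (0 : ℝ) • D e = φ P := by simp
    have hc : HasDerivAt (fun t : ℝ => φ.symm (φ P + t • D e)) e 0 := by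
      have := HasFDerivAt.comp_hasDerivAt (0 : ℝ) (f := fun t : ℝ => φ P + t • D e)
        (l := φ.symm) (by rw [hl0]; exact hsy) hl
      rwa [hinv] at this
    refine ⟨_, by simp [φ.left_inv hPφ], ?_, hc⟩
    have hc0 : φ.symm (φ P + (0 : ℝ) • D e) = P := by rw [hl0, φ.left_inv hPφ]
    have e1 : ∀ᶠ t in 𝓝 (0 : ℝ), φ P + t • D e ∈ φ.target :=
      hl.continuousAt.eventually (by
        change _ ∈ 𝓝 (φ P + (0 : ℝ) • D e)
        rw [hl0]; exact φ.open_target.mem_nhds (φ.map_source hPφ))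
    have e2 := hc.continuousAt.eventually (p := fun y => y ∈ φ.source ∧ y ∈ N) (by
      change ∀ᶠ y in 𝓝 (φ.symm (φ P + (0 : ℝ) • D e)), _
      rw [hc0]; exact hev)
    filter_upwards [e1, e2] with t h1 h2
    refine (h _ h2.1 h2.2).2 ?_
    rw [φ.right_inv h1]
    exact L.add_mem hPL (L.smul_mem _ he)

end Geometry

/-! ### Time reversal -/

/-- A linear involution `ρ` that reverses the vector field exchanges stable and unstable sets. -/
theorem localStableSet_eq_preimage_of_reversal {E : Type*} [NormedAddCommGroup E]
    [NormedSpace ℝ E] {X : E → E} (ρ : E →L[ℝ] E) (hρ : ∀ x, ρ (ρ x) = x)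
    (hX : ∀ x, X (ρ x) = -ρ (X x)) (S N : Set E) (P : E) :
    localStableSet X (ρ ⁻¹' S) (ρ ⁻¹' N) P = ρ ⁻¹' localUnstableSet X S N (ρ P) := by
  ext x
  constructor
  · rintro ⟨γ, h0, hi, hm, hl⟩
    refine ⟨fun t => ρ (γ (-t)), by simp [h0], ?_, fun t ht => hm (-t) (by simpa using ht), ?_⟩
    · intro t ht
      have h1 := hi (-t) (by simpa using ht)
      have h2 : HasDerivWithinAt (fun s : ℝ => γ (-s)) ((-1 : ℝ) • X (γ (-t))) (Iic 0) t :=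
        h1.scomp t (hasDerivAt_neg t).hasDerivWithinAt (fun s hs => by simpa using hs)
      have h3 := ρ.hasFDerivAt.comp_hasDerivWithinAt t h2
      simpa [hX, Function.comp_def] using h3
    · exact (ρ.continuous.tendsto P).comp (hl.comp tendsto_neg_atBot_atTop)
  · rintro ⟨γ, h0, hi, hm, hl⟩
    refine ⟨fun t => ρ (γ (-t)), by simp [h0, hρ], ?_, fun t ht => ?_, ?_⟩
    · intro t ht
      have h1 := hi (-t) (by simpa using ht)
      have h2 : HasDerivWithinAt (fun s : ℝ => γ (-s)) ((-1 : ℝ) • X (γ (-t))) (Ici 0) t :=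
        h1.scomp t (hasDerivAt_neg t).hasDerivWithinAt (fun s hs => by simpa using hs)
      have h3 := ρ.hasFDerivAt.comp_hasDerivWithinAt t h2
      simpa [hX, Function.comp_def] using h3
    · simpa [hρ] using hm (-t) (by simpa using ht)
    · simpa [hρ, Function.comp_def] using
        (ρ.continuous.tendsto (ρ P)).comp (hl.comp tendsto_neg_atTop_atBot)

/-! ### Scalar differential inequalities -/

/-- A solution of `r' = a r` with bounded coefficient `a` which vanishes at `0` is zero. -/
theorem eq_zero_of_hasDerivAt_mul {r a : ℝ → ℝ} {s t₁ B : ℝ} (hs : s < 0) (ht₁ : 0 < t₁)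
    (hr : ∀ t ∈ Ioo s t₁, HasDerivAt r (a t * r t) t) (ha : ∀ t ∈ Ioo s t₁, |a t| ≤ B)
    (h0 : r 0 = 0) : ∀ t ∈ Ioo s t₁, r t = 0 := by
  have hd : ∀ c : ℝ, ∀ t ∈ Ioo s t₁, HasDerivAt (fun t => r t ^ 2 * Real.exp (c * t))
      ((2 * a t + c) * (r t ^ 2 * Real.exp (c * t))) t := by
    intro c t ht
    have h1 := ((hr t ht).pow 2).mul (((hasDerivAt_id t).const_mul c).exp)
    refine h1.congr_deriv ?_
    simp only [id, Pi.pow_apply]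
    push_cast
    ring
  have hmono : MonotoneOn (fun t => r t ^ 2 * Real.exp (2 * B * t)) (Ioo s t₁) := by
    refine monotoneOn_of_hasDerivWithinAt_nonneg (convex_Ioo _ _)
      (fun t ht => (hd _ t ht).continuousAt.continuousWithinAt)
      (fun t ht => (hd (2 * B) t (interior_subset ht)).hasDerivWithinAt) (fun t ht => ?_)
    have := (abs_le.1 (ha t (interior_subset ht))).1
    exact mul_nonneg (by linarith) (by positivity)
  have hanti : AntitoneOn (fun t => r t ^ 2 * Real.exp (-(2 * B) * t)) (Ioo s t₁) := by
    refine antitoneOn_of_hasDerivWithinAt_nonpos (convex_Ioo _ _)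
      (fun t ht => (hd _ t ht).continuousAt.continuousWithinAt)
      (fun t ht => (hd (-(2 * B)) t (interior_subset ht)).hasDerivWithinAt) (fun t ht => ?_)
    have := (abs_le.1 (ha t (interior_subset ht))).2
    exact mul_nonpos_of_nonpos_of_nonneg (by linarith) (by positivity)
  intro t ht
  have key : ∀ c : ℝ, r t ^ 2 * Real.exp c ≤ 0 → r t = 0 := by
    intro c hc
    have := Real.exp_pos c
    have h2 : r t ^ 2 ≤ 0 := by
      by_contra! h
      nlinarith [mul_pos h this]
    exact pow_eq_zero_iff (two_ne_zero) |>.1 (le_antisymm h2 (sq_nonneg _))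
  rcases le_total t 0 with h | h
  · exact key _ (by simpa [h0] using hmono ht ⟨hs, ht₁⟩ h)
  · exact key _ (by simpa [h0] using hanti ⟨hs, ht₁⟩ ht h)

/-- Backward in time `|r|` decays like `exp (l t)`, so the growth rate `B |r|` of `K` is integrable
up to `-∞`; hence `K`, which tends to `0` there, cannot leave `0`. -/
theorem nonpos_of_tendsto_atBot {r a K K' : ℝ → ℝ} {l B : ℝ} (hl : 0 < l) (hB : 0 ≤ B)
    (hr : ∀ t ≤ 0, HasDerivWithinAt r (a t * r t) (Iic 0) t) (ha : ∀ t ≤ 0, l ≤ a t)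
    (hK : ∀ t ≤ 0, HasDerivWithinAt K (K' t) (Iic 0) t) (hK' : ∀ t ≤ 0, K' t ≤ B * |r t| * K t)
    (hK0 : ∀ t ≤ 0, 0 ≤ K t) (hlim : Tendsto K atBot (𝓝 0)) : K 0 ≤ 0 := by
  have hdecay : ∀ t ≤ 0, |r t| ≤ |r 0| * Real.exp (l * t) := by
    have hd : ∀ t ≤ 0, HasDerivWithinAt (fun t => r t ^ 2 * Real.exp (-(2 * l) * t))
        ((2 * a t - 2 * l) * (r t ^ 2 * Real.exp (-(2 * l) * t))) (Iic 0) t := by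
      intro t ht
      have h1 := ((hr t ht).pow 2).mul
        (((hasDerivAt_id t).const_mul (-(2 * l))).exp).hasDerivWithinAt
      refine h1.congr_deriv ?_
      simp only [id, Pi.pow_apply]
      push_cast
      ring
    have hmono : MonotoneOn (fun t => r t ^ 2 * Real.exp (-(2 * l) * t)) (Iic 0) := by
      refine monotoneOn_of_hasDerivWithinAt_nonneg (convex_Iic _)
        (fun t ht => (hd t ht).continuousWithinAt)
        (fun t ht => (hd t (interior_subset (s := Iic 0) ht)).mono interior_subset) (fun t ht => ?_)
      have := ha t (interior_subset (s := Iic 0) ht)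
      exact mul_nonneg (by linarith) (by positivity)
    intro t ht
    have h1 : r t ^ 2 * Real.exp (-(2 * l) * t) ≤ r 0 ^ 2 := by
      simpa using hmono ht (mem_Iic.2 le_rfl) ht
    refine abs_le_of_sq_le_sq' ?_ (by positivity) |> abs_le.2
    have h2 : Real.exp (-(2 * l) * t) * Real.exp (l * t) ^ 2 = 1 := by
      rw [← Real.exp_nat_mul, ← Real.exp_add, Real.exp_eq_one_iff]; push_cast; ring
    calc r t ^ 2 = r t ^ 2 * Real.exp (-(2 * l) * t) * Real.exp (l * t) ^ 2 := by
          rw [mul_assoc, h2, mul_one]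
      _ ≤ r 0 ^ 2 * Real.exp (l * t) ^ 2 := by gcongr
      _ = (|r 0| * Real.exp (l * t)) ^ 2 := by rw [mul_pow, sq_abs]
  set k : ℝ := B * |r 0| / l with hk
  have hkl : k * l = B * |r 0| := by rw [hk]; field_simp
  have hd : ∀ t ≤ 0, HasDerivWithinAt (fun t => K t * Real.exp (-k * Real.exp (l * t)))
      ((K' t - B * |r 0| * Real.exp (l * t) * K t) * Real.exp (-k * Real.exp (l * t)))
      (Iic 0) t := by
    intro t ht
    have h1 := (hK t ht).mul
      ((((hasDerivAt_id t).const_mul l).exp).const_mul (-k)).exp.hasDerivWithinAt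
    refine h1.congr_deriv ?_
    simp only [id]
    rw [← hkl]
    ring
  have hanti : AntitoneOn (fun t => K t * Real.exp (-k * Real.exp (l * t))) (Iic 0) := by
    refine antitoneOn_of_hasDerivWithinAt_nonpos (convex_Iic _)
      (fun t ht => (hd t ht).continuousWithinAt)
      (fun t ht => (hd t (interior_subset (s := Iic 0) ht)).mono interior_subset) (fun t ht => ?_)
    have ht0 : t ≤ 0 := interior_subset (s := Iic 0) ht
    refine mul_nonpos_of_nonpos_of_nonneg ?_ (by positivity)
    have : B * |r t| * K t ≤ B * (|r 0| * Real.exp (l * t)) * K t :=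
      mul_le_mul_of_nonneg_right (mul_le_mul_of_nonneg_left (hdecay t ht0) hB) (hK0 t ht0)
    linarith [hK' t ht0]
  have hlim' : Tendsto (fun t => K t * Real.exp (-k * Real.exp (l * t))) atBot (𝓝 0) := by
    have h1 : Tendsto (fun t : ℝ => Real.exp (l * t)) atBot (𝓝 0) :=
      Real.tendsto_exp_atBot.comp (tendsto_id.const_mul_atBot hl)
    simpa using hlim.mul ((Real.continuous_exp.tendsto _).comp (h1.const_mul (-k)))
  have h0 : K 0 * Real.exp (-k * Real.exp (l * 0)) ≤ 0 := by
    refine ge_of_tendsto hlim' ?_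
    filter_upwards [eventually_le_atBot 0] with t ht
    exact hanti ht (mem_Iic.2 le_rfl) ht
  by_contra! h
  nlinarith [mul_pos h (Real.exp_pos (-k * Real.exp (l * 0)))]

/-! ### Spectral subspaces of a line plus a rotation -/

section Spectral

variable {T : Type*} [AddCommGroup T] [Module ℝ T]

theorem charpoly_of_line_plus_rotation [Module.Finite ℝ T] (A : Module.End ℝ T)
    (e : T ≃ₗ[ℝ] (Fin 3 → ℝ)) {l b : ℝ} (hA : ∀ x, e (A x) = ![l * e x 0, e x 2, -b ^ 2 * e x 1]) :
    A.charpoly = (Polynomial.X - Polynomial.C l) * (Polynomial.X ^ 2 + Polynomial.C (b ^ 2)) := by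
  have hM : LinearMap.toMatrix (Module.Basis.ofEquivFun e) (Module.Basis.ofEquivFun e) A =
      !![l, 0, 0; 0, 0, 1; 0, -b ^ 2, 0] := by
    ext i j
    rw [LinearMap.toMatrix_apply]
    fin_cases i <;> fin_cases j <;> simp [hA]
  rw [← LinearMap.charpoly_toMatrix A (Module.Basis.ofEquivFun e), hM, Matrix.charpoly,
    Matrix.det_fin_three]
  simp
  ring

/-- The coordinates of the polynomial in `A` that belongs to the pair `z`, `conj z`. -/
theorem coord_quadratic (A : Module.End ℝ T) (e : T ≃ₗ[ℝ] (Fin 3 → ℝ)) {l b : ℝ}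
    (hA : ∀ x, e (A x) = ![l * e x 0, e x 2, -b ^ 2 * e x 1]) (z : ℂ) (x : T) :
    e ((A ^ 2 - (2 * z.re) • A + (Complex.normSq z) • (1 : Module.End ℝ T)) x) =
      ![((l - z.re) ^ 2 + z.im ^ 2) * e x 0,
        (Complex.normSq z - b ^ 2) * e x 1 - 2 * z.re * e x 2,
        (Complex.normSq z - b ^ 2) * e x 2 + 2 * z.re * b ^ 2 * e x 1] := by
  ext i
  fin_cases i <;> simp [pow_two, hA, Complex.normSq_apply] <;> ring

theorem coord_zero_of_mem_spectralSubspace {A : Module.End ℝ T} {e : T ≃ₗ[ℝ] (Fin 3 → ℝ)}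
    {l b : ℝ} (hA : ∀ x, e (A x) = ![l * e x 0, e x 2, -b ^ 2 * e x 1]) {Z : Set ℂ}
    (hZ : ∀ z ∈ Z, z.re ≠ l) {x : T} (hx : x ∈ spectralSubspace A Z) : e x 0 = 0 := by
  let q : T →ₗ[ℝ] ℝ := LinearMap.proj 0 ∘ₗ e.toLinearMap
  suffices h : spectralSubspace A Z ≤ LinearMap.ker q from h hx
  refine iSup₂_le fun z hz => iSup_le fun n => ?_
  induction n with
  | zero => intro y hy; have : y = 0 := by simpa using hy
            simp [this]
  | succ n ih =>
    intro y hy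
    rw [LinearMap.mem_ker, pow_succ, Module.End.mul_apply] at hy
    have h1 : e ((A ^ 2 - (2 * z.re) • A + (Complex.normSq z) • (1 : Module.End ℝ T)) y) 0 = 0 :=
      ih hy
    rw [coord_quadratic A e hA] at h1
    have h2 : (l - z.re) ^ 2 + z.im ^ 2 ≠ 0 := by
      have : l - z.re ≠ 0 := sub_ne_zero.2 (hZ z hz).symm
      positivity
    exact (mul_eq_zero.1 h1).resolve_left h2

theorem coord_one_two_of_mem_spectralSubspace {A : Module.End ℝ T} {e : T ≃ₗ[ℝ] (Fin 3 → ℝ)}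
    {l b : ℝ} (hb : b ≠ 0) (hA : ∀ x, e (A x) = ![l * e x 0, e x 2, -b ^ 2 * e x 1]) {Z : Set ℂ}
    (hZ : ∀ z ∈ Z, z.re ≠ 0) {x : T} (hx : x ∈ spectralSubspace A Z) :
    e x 1 = 0 ∧ e x 2 = 0 := by
  let q₁ : T →ₗ[ℝ] ℝ := LinearMap.proj 1 ∘ₗ e.toLinearMap
  let q₂ : T →ₗ[ℝ] ℝ := LinearMap.proj 2 ∘ₗ e.toLinearMap
  suffices h : spectralSubspace A Z ≤ LinearMap.ker q₁ ⊓ LinearMap.ker q₂ from h hx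
  refine iSup₂_le fun z hz => iSup_le fun n => ?_
  induction n with
  | zero => intro y hy; have : y = 0 := by simpa using hy
            simp [this]
  | succ n ih =>
    intro y hy
    rw [LinearMap.mem_ker, pow_succ, Module.End.mul_apply] at hy
    have h1 : e ((A ^ 2 - (2 * z.re) • A + (Complex.normSq z) • (1 : Module.End ℝ T)) y) 1 = 0 :=
      (ih hy).1
    have h2 : e ((A ^ 2 - (2 * z.re) • A + (Complex.normSq z) • (1 : Module.End ℝ T)) y) 2 = 0 :=
      (ih hy).2
    rw [coord_quadratic A e hA] at h1 h2
    replace h1 : (Complex.normSq z - b ^ 2) * e y 1 - 2 * z.re * e y 2 = 0 := h1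
    replace h2 : (Complex.normSq z - b ^ 2) * e y 2 + 2 * z.re * b ^ 2 * e y 1 = 0 := h2
    -- the determinant of the rotation block
    have hdet : (Complex.normSq z - b ^ 2) ^ 2 + (2 * z.re * b) ^ 2 ≠ 0 := by
      have := hZ z hz
      positivity
    constructor
    · refine (mul_eq_zero.1 ?_).resolve_left hdet
      change _ * e y 1 = 0
      linear_combination (Complex.normSq z - b ^ 2) * h1 + 2 * z.re * h2
    · refine (mul_eq_zero.1 ?_).resolve_left hdet
      change _ * e y 2 = 0
      linear_combination (Complex.normSq z - b ^ 2) * h2 - 2 * z.re * b ^ 2 * h1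

theorem mem_spectralSubspace_line {A : Module.End ℝ T} {e : T ≃ₗ[ℝ] (Fin 3 → ℝ)} {l b : ℝ}
    (hb : b ≠ 0) (hA : ∀ x, e (A x) = ![l * e x 0, e x 2, -b ^ 2 * e x 1]) {Z : Set ℂ}
    (hl : (l : ℂ) ∈ Z) (hZ : ∀ z ∈ Z, z.re ≠ 0) (x : T) :
    x ∈ spectralSubspace A Z ↔ e x 1 = 0 ∧ e x 2 = 0 := by
  refine ⟨coord_one_two_of_mem_spectralSubspace hb hA hZ, fun h => ?_⟩
  refine Submodule.mem_iSup_of_mem (l : ℂ) (Submodule.mem_iSup_of_mem hl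
    (Submodule.mem_iSup_of_mem 1 ?_))
  rw [pow_one, LinearMap.mem_ker, ← e.map_eq_zero_iff, coord_quadratic A e hA]
  ext i
  fin_cases i <;> simp [h.1, h.2]

theorem mem_centreSubspace_plane {A : Module.End ℝ T} {e : T ≃ₗ[ℝ] (Fin 3 → ℝ)} {l b : ℝ}
    (hl : l ≠ 0) (hA : ∀ x, e (A x) = ![l * e x 0, e x 2, -b ^ 2 * e x 1]) (x : T) :
    x ∈ centreSubspace A ↔ e x 0 = 0 := by
  refine ⟨coord_zero_of_mem_spectralSubspace hA (fun z (hz : z.re = 0) => hz ▸ hl.symm),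
    fun h => ?_⟩
  refine Submodule.mem_iSup_of_mem (⟨0, b⟩ : ℂ) (Submodule.mem_iSup_of_mem (by simp)
    (Submodule.mem_iSup_of_mem 1 ?_))
  rw [pow_one, LinearMap.mem_ker, ← e.map_eq_zero_iff, coord_quadratic A e hA]
  ext i
  fin_cases i <;> simp [h, Complex.normSq_apply] <;> ring_nf <;> simp

theorem spectralSubspace_eq_bot {A : Module.End ℝ T} {e : T ≃ₗ[ℝ] (Fin 3 → ℝ)} {l b : ℝ}
    (hb : b ≠ 0) (hA : ∀ x, e (A x) = ![l * e x 0, e x 2, -b ^ 2 * e x 1]) {Z : Set ℂ}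
    (hl : ∀ z ∈ Z, z.re ≠ l) (hZ : ∀ z ∈ Z, z.re ≠ 0) : spectralSubspace A Z = ⊥ := by
  refine (Submodule.eq_bot_iff _).2 fun x hx => ?_
  have h0 := coord_zero_of_mem_spectralSubspace hA hl hx
  have h1 := coord_one_two_of_mem_spectralSubspace hb hA hZ hx
  rw [← e.map_eq_zero_iff]
  ext i
  fin_cases i
  exacts [h0, h1.1, h1.2]

end Spectral

/-! ### The potentials -/

namespace Manev.Params

/-- The positivity of the masses and of the constants of the interaction. -/
structure Positive (p : Params) : Prop where
  G : 0 < p.G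
  M : 0 < p.M
  m : 0 < p.m
  γ₀ : 0 < p.γ₀
  γ : 0 < p.γ

variable {p : Params}

theorem Positive.μ_pos (hp : p.Positive) : 0 < p.μ := by
  have := hp.M; have := hp.m
  unfold μ; positivity

theorem Positive.denom_pos (hp : p.Positive) (θ : ℝ) :
    0 < Real.cos θ ^ 2 + p.μ * Real.sin θ ^ 2 := by
  have h := hp.μ_pos
  rcases eq_or_ne (Real.cos θ) 0 with hc | hc
  · have : Real.sin θ ^ 2 = 1 := by have := Real.sin_sq_add_cos_sq θ; rw [hc] at this; linarith
    rw [hc, this]; linarith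
  · positivity

theorem U_eq {θ : ℝ} (hc : Real.cos θ ≠ 0) :
    p.U θ = p.G * p.M ^ 2 / 2 * (p.M * p.γ₀ +
      8 * p.m * p.γ * (Real.cos θ ^ 2 / (Real.cos θ ^ 2 + p.μ * Real.sin θ ^ 2))) := by
  unfold U W
  field_simp

theorem U_zero : p.U 0 = p.G * p.M ^ 2 / 2 * (p.M * p.γ₀ + 8 * p.m * p.γ) := by
  rw [U_eq (by simp)]; simp

theorem Positive.U_pos (hp : p.Positive) {θ : ℝ} (hc : Real.cos θ ≠ 0) : 0 < p.U θ := by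
  have := hp.G; have := hp.M; have := hp.m; have := hp.γ₀; have := hp.γ
  have := hp.denom_pos θ
  rw [U_eq hc]
  positivity

theorem cos_pos_of_mem {x : Phase} (hx : x ∈ domain) : 0 < Real.cos x.2.2.1 :=
  Real.cos_pos_of_mem_Ioo hx

theorem Positive.contDiffOn_V (hp : p.Positive) :
    ContDiffOn ℝ ∞ p.V (Ioo (-(Real.pi / 2)) (Real.pi / 2)) := by
  intro θ hθ
  have hc : Real.cos θ ≠ 0 := (Real.cos_pos_of_mem_Ioo hθ).ne'
  have hd := hp.denom_pos θ
  have hs : √(Real.cos θ ^ 2 + p.μ * Real.sin θ ^ 2) ≠ 0 := (Real.sqrt_pos.2 hd).ne'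
  have hcos : ContDiffAt ℝ ∞ Real.cos θ := Real.contDiff_cos.contDiffAt
  have hsin : ContDiffAt ℝ ∞ Real.sin θ := Real.contDiff_sin.contDiffAt
  have hD : ContDiffAt ℝ ∞ (fun θ => Real.cos θ ^ 2 + p.μ * Real.sin θ ^ 2) θ :=
    (hcos.pow 2).add (contDiffAt_const.mul (hsin.pow 2))
  exact (contDiffAt_const.mul ((contDiffAt_const.div hcos hc).add
    (contDiffAt_const.div (hD.sqrt hd.ne') hs))).contDiffWithinAt

theorem Positive.contDiffOn_U (hp : p.Positive) :
    ContDiffOn ℝ ∞ p.U (Ioo (-(Real.pi / 2)) (Real.pi / 2)) := by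
  intro θ hθ
  have hc : Real.cos θ ≠ 0 := (Real.cos_pos_of_mem_Ioo hθ).ne'
  have hd := hp.denom_pos θ
  have hcos : ContDiffAt ℝ ∞ Real.cos θ := Real.contDiff_cos.contDiffAt
  have hsin : ContDiffAt ℝ ∞ Real.sin θ := Real.contDiff_sin.contDiffAt
  have hD : ContDiffAt ℝ ∞ (fun θ => Real.cos θ ^ 2 + p.μ * Real.sin θ ^ 2) θ :=
    (hcos.pow 2).add (contDiffAt_const.mul (hsin.pow 2))
  exact ((contDiffAt_const.mul ((contDiffAt_const.div (hcos.pow 2) (pow_ne_zero 2 hc)).add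
    (contDiffAt_const.div hD hd.ne'))).mul (hcos.pow 2)).contDiffWithinAt

theorem Positive.hasDerivAt_V (hp : p.Positive) {θ : ℝ}
    (hθ : θ ∈ Ioo (-(Real.pi / 2)) (Real.pi / 2)) : HasDerivAt p.V (deriv p.V θ) θ :=
  ((hp.contDiffOn_V.contDiffAt (isOpen_Ioo.mem_nhds hθ)).differentiableAt (by simp)).hasDerivAt

theorem Positive.hasDerivAt_U (hp : p.Positive) {θ : ℝ}
    (hθ : θ ∈ Ioo (-(Real.pi / 2)) (Real.pi / 2)) : HasDerivAt p.U (deriv p.U θ) θ :=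
  ((hp.contDiffOn_U.contDiffAt (isOpen_Ioo.mem_nhds hθ)).differentiableAt (by simp)).hasDerivAt

theorem zero_mem_Ioo_pi : (0 : ℝ) ∈ Ioo (-(Real.pi / 2)) (Real.pi / 2) :=
  ⟨by linarith [Real.pi_pos], by linarith [Real.pi_pos]⟩

theorem deriv_zero_of_even {f : ℝ → ℝ} (hf : f.Even) : deriv f 0 = 0 := by
  have h := deriv_comp_neg f 0
  rw [funext hf, neg_zero] at h
  linarith

theorem deriv_V_zero : deriv p.V 0 = 0 := deriv_zero_of_even fun θ => by simp [V]

theorem deriv_U_zero : deriv p.U 0 = 0 := deriv_zero_of_even fun θ => by simp [U, W]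

theorem Positive.hasDerivAt_deriv_V_zero (hp : p.Positive) :
    HasDerivAt (deriv p.V) (deriv (deriv p.V) 0) 0 :=
  (((hp.contDiffOn_V.deriv_of_isOpen isOpen_Ioo (m := ∞) (by simp)).contDiffAt
    (isOpen_Ioo.mem_nhds zero_mem_Ioo_pi)).differentiableAt (by simp)).hasDerivAt

theorem Positive.deriv_U_eq (hp : p.Positive) {θ : ℝ}
    (hθ : θ ∈ Ioo (-(Real.pi / 2)) (Real.pi / 2)) :
    deriv p.U θ = -(8 * p.G * p.M ^ 2 * p.m * p.γ * p.μ) * (Real.cos θ * Real.sin θ /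
      (Real.cos θ ^ 2 + p.μ * Real.sin θ ^ 2) ^ 2) := by
  have hd := (hp.denom_pos θ).ne'
  have h1 : HasDerivAt (fun θ => Real.cos θ ^ 2) (2 * Real.cos θ * -Real.sin θ) θ := by
    simpa [Pi.pow_def] using (Real.hasDerivAt_cos θ).pow 2
  have h2 : HasDerivAt (fun θ => Real.sin θ ^ 2) (2 * Real.sin θ * Real.cos θ) θ := by
    simpa [Pi.pow_def] using (Real.hasDerivAt_sin θ).pow 2
  have h3 := (((h1.div (h1.add (h2.const_mul p.μ)) hd).const_mul (8 * p.m * p.γ)).const_add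
    (p.M * p.γ₀)).const_mul (p.G * p.M ^ 2 / 2)
  have h4 := h3.congr_of_eventuallyEq (f₁ := p.U) (by
    filter_upwards [isOpen_Ioo.mem_nhds hθ] with t ht
    rw [U_eq (Real.cos_pos_of_mem_Ioo ht).ne']
    rfl)
  rw [h4.deriv]
  simp only [Pi.add_apply]
  have hcs := Real.sin_sq_add_cos_sq θ
  rw [← mul_div_assoc, ← mul_div_assoc, ← mul_div_assoc]
  congr 1
  linear_combination (-(8 * p.G * p.M ^ 2 * p.m * p.γ * p.μ) * Real.cos θ * Real.sin θ) * hcs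

theorem Positive.hasDerivAt_deriv_U_zero (hp : p.Positive) :
    HasDerivAt (deriv p.U) (-(8 * p.G * p.M ^ 2 * p.m * p.γ * p.μ)) 0 := by
  have hd : Real.cos 0 ^ 2 + p.μ * Real.sin 0 ^ 2 ≠ 0 := (hp.denom_pos 0).ne'
  have h1 := (Real.hasDerivAt_cos 0).pow 2
  have h2 := (Real.hasDerivAt_sin 0).pow 2
  have h3 := (((Real.hasDerivAt_cos 0).mul (Real.hasDerivAt_sin 0)).div
    ((h1.add (h2.const_mul p.μ)).pow 2) (pow_ne_zero 2 hd)).const_mul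
      (-(8 * p.G * p.M ^ 2 * p.m * p.γ * p.μ))
  have h4 := h3.congr_of_eventuallyEq (f₁ := deriv p.U) (by
    filter_upwards [isOpen_Ioo.mem_nhds zero_mem_Ioo_pi] with t ht
    rw [hp.deriv_U_eq ht]
    rfl)
  refine h4.congr_deriv ?_
  simp

/-- The square of the frequency of the oscillations in `θ` at `P±`. -/
noncomputable def freqSq (p : Params) (C : ℝ) : ℝ :=
  (C ^ 2 - 2 * p.U 0 + 8 * p.G * p.M ^ 2 * p.m * p.γ * p.μ) / p.U 0

theorem Positive.freqSq_pos (hp : p.Positive) (h16 : p.γ₀ < 16 * p.γ) (C : ℝ) :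
    0 < p.freqSq C := by
  have := hp.G; have := hp.M; have := hp.m
  refine div_pos ?_ (hp.U_pos (by simp))
  have : C ^ 2 - 2 * p.U 0 + 8 * p.G * p.M ^ 2 * p.m * p.γ * p.μ =
      C ^ 2 + p.G * p.M ^ 3 * (16 * p.γ - p.γ₀) := by
    rw [U_zero, μ]; field_simp; ring
  rw [this]
  have : 0 < 16 * p.γ - p.γ₀ := by linarith
  positivity

/-- The potential `(C² - 2 U) / cos²` of the motion in `θ` on the collision manifold has a
nondegenerate minimum at `θ = 0`; in terms of `tan θ` it is a multiple of `tan² θ`, and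
`γ₀ < 16 γ` makes the factor positive. -/
theorem Positive.exists_potential_ge (hp : p.Positive) (h16 : p.γ₀ < 16 * p.γ) (C : ℝ) :
    ∃ c > 0, ∀ᶠ θ in 𝓝 (0 : ℝ),
      c * θ ^ 2 ≤ 2 * p.U 0 - C ^ 2 - (2 * p.U θ - C ^ 2) / Real.cos θ ^ 2 := by
  have hG := hp.G; have hM := hp.M; have hm := hp.m; have hμ := hp.μ_pos
  have h16' : 0 < 16 * p.γ - p.γ₀ := by linarith
  refine ⟨p.G * p.M ^ 3 * ((16 * p.γ - p.γ₀) / 2), by positivity, ?_⟩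
  have hcont : ContinuousAt (fun θ => 16 * p.γ *
      (Real.cos θ ^ 2 / (Real.cos θ ^ 2 + p.μ * Real.sin θ ^ 2)) - p.γ₀) 0 := by
    have := (hp.denom_pos 0).ne'
    fun_prop (disch := exact this)
  have hev := hcont.eventually (lt_mem_nhds (a := (16 * p.γ - p.γ₀) / 2)
    (by simp; linarith))
  filter_upwards [hev, isOpen_Ioo.mem_nhds zero_mem_Ioo_pi] with θ h1 hθ
  have hc := Real.cos_pos_of_mem_Ioo hθ
  have hd := hp.denom_pos θ
  have hcs := Real.sin_sq_add_cos_sq θ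
  have heq : 2 * p.U 0 - C ^ 2 - (2 * p.U θ - C ^ 2) / Real.cos θ ^ 2 = Real.tan θ ^ 2 *
      (C ^ 2 + p.G * p.M ^ 3 * (16 * p.γ *
        (Real.cos θ ^ 2 / (Real.cos θ ^ 2 + p.μ * Real.sin θ ^ 2)) - p.γ₀)) := by
    have hμ' : p.m * p.μ = 2 * p.M + p.m := by rw [μ]; field_simp
    have hs : Real.sin θ ^ 2 = 1 - Real.cos θ ^ 2 := by linarith
    rw [U_zero, U_eq hc.ne', Real.tan_eq_sin_div_cos, div_pow, hs]
    rw [hs] at hd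
    field_simp
    linear_combination (8 * p.G * p.M ^ 2 * p.γ * Real.cos θ ^ 2 * (1 - Real.cos θ ^ 2)) * hμ'
  have htan : θ ^ 2 ≤ Real.tan θ ^ 2 := by
    rcases le_total 0 θ with h | h
    · exact pow_le_pow_left₀ h (Real.le_tan h hθ.2) 2
    · have := pow_le_pow_left₀ (neg_nonneg.2 h)
        (Real.le_tan (neg_nonneg.2 h) (by linarith [hθ.1])) 2
      simpa [Real.tan_neg] using this
  rw [heq]
  calc _ ≤ (p.G * p.M ^ 3 * ((16 * p.γ - p.γ₀) / 2)) * Real.tan θ ^ 2 := by gcongr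
    _ ≤ _ := by
      rw [mul_comm]
      refine mul_le_mul_of_nonneg_left ?_ (sq_nonneg _)
      have : p.G * p.M ^ 3 * ((16 * p.γ - p.γ₀) / 2) ≤ p.G * p.M ^ 3 * (16 * p.γ *
        (Real.cos θ ^ 2 / (Real.cos θ ^ 2 + p.μ * Real.sin θ ^ 2)) - p.γ₀) := by
        gcongr
      nlinarith [sq_nonneg C]

theorem Positive.exists_abs_deriv_V_le (hp : p.Positive) :
    ∃ B > 0, ∀ᶠ θ in 𝓝 (0 : ℝ), |deriv p.V θ| ≤ B * |θ| := by
  obtain ⟨B, hB, h⟩ := hp.hasDerivAt_deriv_V_zero.differentiableAt.isBigO_sub.exists_pos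
  refine ⟨B, hB, ?_⟩
  simpa [deriv_V_zero] using h.bound

variable {h C : ℝ}

/-! ### The first integral -/

/-- The value of `v ^ 2` that puts a point with given `r`, `θ`, `w` on the energy level. -/
noncomputable def speedSq (p : Params) (h C : ℝ) (x : Phase) : ℝ :=
  2 * h * x.1 ^ 2 + 2 * x.1 * p.V x.2.2.1 + (2 * p.U x.2.2.1 - C ^ 2) / Real.cos x.2.2.1 ^ 2
    - x.2.2.2 ^ 2 * (p.U x.2.2.1 / Real.cos x.2.2.1 ^ 4)

/-- The function `F / cos⁴ θ`. Along solutions `F' = -4 w tan θ F`, so that this quotient is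
constant. -/
noncomputable def firstIntegral (p : Params) (h C : ℝ) (x : Phase) : ℝ :=
  p.speedSq h C x - x.2.1 ^ 2

theorem F_eq {x : Phase} (hx : x ∈ domain) :
    p.F h C x = p.firstIntegral h C x * Real.cos x.2.2.1 ^ 4 := by
  have hc := (cos_pos_of_mem hx).ne'
  unfold firstIntegral speedSq F
  field_simp
  ring

theorem mem_energyLevel {x : Phase} :
    x ∈ p.energyLevel h C ↔ x ∈ domain ∧ p.firstIntegral h C x = 0 := by
  refine and_congr_right fun hx => ?_
  rw [F_eq hx]
  simp [(cos_pos_of_mem hx).ne']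

theorem isOpen_domain : IsOpen domain :=
  isOpen_Ioo.preimage (by fun_prop : Continuous fun x : Phase => x.2.2.1)

/-- The derivative of `speedSq` along a solution is that of `v ^ 2`. -/
theorem Positive.hasDerivWithinAt_speedSq (hp : p.Positive) {γ : ℝ → Phase} {s : Set ℝ} {t : ℝ}
    (hγ : HasDerivWithinAt γ (p.field h C (γ t)) s t) (hd : γ t ∈ domain) :
    HasDerivWithinAt (fun t => p.speedSq h C (γ t))
      (2 * (γ t).2.1 * (p.field h C (γ t)).2.1) s t := by
  have hr : HasDerivWithinAt (fun t => (γ t).1) _ s t := hγ.hasFDerivWithinAt.fst.hasDerivWithinAt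
  have hθ : HasDerivWithinAt (fun t => (γ t).2.2.1) _ s t :=
    hγ.hasFDerivWithinAt.snd.snd.fst.hasDerivWithinAt
  have hw : HasDerivWithinAt (fun t => (γ t).2.2.2) _ s t :=
    hγ.hasFDerivWithinAt.snd.snd.snd.hasDerivWithinAt
  have hV := (hp.hasDerivAt_V hd).comp_hasDerivWithinAt t hθ
  have hU := (hp.hasDerivAt_U hd).comp_hasDerivWithinAt t hθ
  have hcos := (Real.hasDerivAt_cos _).comp_hasDerivWithinAt t hθ
  have hc := (cos_pos_of_mem hd).ne'
  have hU0 := (hp.U_pos hc).ne'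
  have hk := ((((hr.pow 2).const_mul (2 * h)).add ((hr.const_mul 2).mul hV)).add
    (((hU.const_mul 2).sub_const (C ^ 2)).div (hcos.pow 2) (pow_ne_zero 2 hc))).sub
    ((hw.pow 2).mul (hU.div (hcos.pow 4) (pow_ne_zero 4 hc)))
  refine hk.congr_deriv ?_
  simp only [field, Real.tan_eq_sin_div_cos, Function.comp_def, Pi.pow_apply, Pi.div_apply,
    ContinuousLinearMap.comp_apply, ContinuousLinearMap.coe_fst',
    ContinuousLinearMap.coe_snd', ContinuousLinearMap.toSpanSingleton_apply, one_smul]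
  have hsq := (Real.sqrt_pos.2 (hp.U_pos hc)).ne'
  push_cast
  field_simp
  ring

theorem Positive.hasDerivWithinAt_firstIntegral (hp : p.Positive) {γ : ℝ → Phase} {s : Set ℝ}
    {t : ℝ} (hγ : HasDerivWithinAt γ (p.field h C (γ t)) s t) (hd : γ t ∈ domain) :
    HasDerivWithinAt (fun t => p.firstIntegral h C (γ t)) 0 s t := by
  have hv : HasDerivWithinAt (fun t => (γ t).2.1) _ s t :=
    hγ.hasFDerivWithinAt.snd.fst.hasDerivWithinAt
  refine ((hp.hasDerivWithinAt_speedSq hγ hd).sub (hv.pow 2)).congr_deriv ?_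
  simp

theorem Positive.isLocallyInvariant_energyLevel (hp : p.Positive) :
    IsLocallyInvariant (p.field h C) domain (p.energyLevel h C) := by
  intro γ a b ha hb hγ hN h0 t ht
  have h1 : ∀ t ∈ Ioo a b, HasDerivAt (fun t => p.firstIntegral h C (γ t)) 0 t := fun t ht =>
    (hp.hasDerivWithinAt_firstIntegral (hγ t ht) (hN t ht)).hasDerivAt (isOpen_Ioo.mem_nhds ht)
  have h2 := isOpen_Ioo.is_const_of_deriv_eq_zero isPreconnected_Ioo
    (fun t ht => (h1 t ht).differentiableAt.differentiableWithinAt) (fun t ht => (h1 t ht).deriv)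
    ht ⟨ha, hb⟩
  exact mem_energyLevel.2 ⟨hN t ht, h2.trans (mem_energyLevel.1 h0).2⟩

/-! ### The chart `(r, F / cos⁴ θ, θ, w)` -/

theorem Positive.contDiffOn_speedSq (hp : p.Positive) :
    ContDiffOn ℝ ∞ (p.speedSq h C) domain := by
  have hθ : ContDiffOn ℝ ∞ (fun x : Phase => x.2.2.1) domain := by fun_prop
  have hV : ContDiffOn ℝ ∞ (fun x : Phase => p.V x.2.2.1) domain :=
    hp.contDiffOn_V.comp hθ fun _ hx => hx
  have hU : ContDiffOn ℝ ∞ (fun x : Phase => p.U x.2.2.1) domain :=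
    hp.contDiffOn_U.comp hθ fun _ hx => hx
  have hcos : ContDiffOn ℝ ∞ (fun x : Phase => Real.cos x.2.2.1) domain :=
    Real.contDiff_cos.comp_contDiffOn hθ
  have hc : ∀ n : ℕ, ∀ x ∈ domain, Real.cos x.2.2.1 ^ n ≠ 0 := fun n x hx =>
    pow_ne_zero n (cos_pos_of_mem hx).ne'
  have hr : ContDiffOn ℝ ∞ (fun x : Phase => x.1) domain := by fun_prop
  have hw : ContDiffOn ℝ ∞ (fun x : Phase => x.2.2.2) domain := by fun_prop
  exact (((contDiffOn_const.mul (hr.pow 2)).add ((contDiffOn_const.mul hr).mul hV)).add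
    (((contDiffOn_const.mul hU).sub contDiffOn_const).div (hcos.pow 2) (hc 2))).sub
    ((hw.pow 2).mul (hU.div (hcos.pow 4) (hc 4)))

/-- On the half `0 < σ v` of the phase space (`σ = ±1`) the map
`(r, v, θ, w) ↦ (r, F / cos⁴ θ, θ, w)` is a change of coordinates; it is inverted by solving for
`v`. -/
noncomputable def chart (hp : p.Positive) (h C : ℝ) {σ : ℝ} (hσ : σ * σ = 1) :
    OpenPartialHomeomorph Phase Phase where
  toFun x := (x.1, p.firstIntegral h C x, x.2.2)
  invFun y := (y.1, σ * √(p.speedSq h C y - y.2.1), y.2.2)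
  source := domain ∩ {x | 0 < σ * x.2.1}
  target := domain ∩ {y | 0 < p.speedSq h C y - y.2.1}
  map_source' := by
    rintro x ⟨hx, hv⟩
    refine ⟨hx, ?_⟩
    have hv0 : x.2.1 ≠ 0 := fun hh => by simp [hh] at hv
    change 0 < p.speedSq h C x - (p.speedSq h C x - x.2.1 ^ 2)
    rw [sub_sub_cancel]
    positivity
  map_target' := by
    rintro y ⟨hy, hv⟩
    refine ⟨hy, ?_⟩
    change 0 < σ * (σ * √(p.speedSq h C y - y.2.1))
    rw [← mul_assoc, hσ, one_mul]
    exact Real.sqrt_pos.2 hv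
  left_inv' := by
    rintro x ⟨hx, hv⟩
    have h1 : p.speedSq h C x - p.firstIntegral h C x = (σ * x.2.1) ^ 2 := by
      rw [firstIntegral, mul_pow, pow_two σ, hσ]; ring
    have h2 : σ * √(p.speedSq h C x - p.firstIntegral h C x) = x.2.1 := by
      rw [h1, Real.sqrt_sq (le_of_lt hv), ← mul_assoc, hσ, one_mul]
    exact Prod.ext rfl (Prod.ext h2 rfl)
  right_inv' := by
    rintro y ⟨hy, hv⟩
    have h2 : p.speedSq h C y - (σ * √(p.speedSq h C y - y.2.1)) ^ 2 = y.2.1 := by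
      rw [mul_pow, pow_two σ, hσ, Real.sq_sqrt (le_of_lt hv)]; ring
    exact Prod.ext rfl (Prod.ext h2 rfl)
  open_source := isOpen_domain.inter
    (isOpen_lt continuous_const (by fun_prop))
  open_target := (hp.contDiffOn_speedSq.continuousOn.sub (by fun_prop)).isOpen_inter_preimage
    isOpen_domain isOpen_Ioi
  continuousOn_toFun := by
    have h1 : ContinuousOn (p.firstIntegral h C) (domain ∩ {x | 0 < σ * x.2.1}) :=
      (hp.contDiffOn_speedSq.continuousOn.mono inter_subset_left).sub (by fun_prop)
    fun_prop
  continuousOn_invFun := by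
    have h1 : ContinuousOn (p.speedSq h C) (domain ∩ {y | 0 < p.speedSq h C y - y.2.1}) :=
      hp.contDiffOn_speedSq.continuousOn.mono inter_subset_left
    fun_prop

section chart

variable (hp : p.Positive) {σ : ℝ} (hσ : σ * σ = 1)

theorem contDiffOn_chart : ContDiffOn ℝ ∞ (chart hp h C hσ) (chart hp h C hσ).source := by
  have h1 : ContDiffOn ℝ ∞ (p.firstIntegral h C) (chart hp h C hσ).source :=
    (hp.contDiffOn_speedSq.mono inter_subset_left).sub (by fun_prop)
  exact (by fun_prop : ContDiffOn ℝ ∞ (fun x : Phase => x.1) _).prodMk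
    (h1.prodMk (by fun_prop : ContDiffOn ℝ ∞ (fun x : Phase => x.2.2) _))

theorem contDiffOn_chart_symm :
    ContDiffOn ℝ ∞ (chart hp h C hσ).symm (chart hp h C hσ).target := by
  have h1 : ContDiffOn ℝ ∞ (fun y : Phase => p.speedSq h C y - y.2.1)
      (chart hp h C hσ).target :=
    (hp.contDiffOn_speedSq.mono inter_subset_left).sub (by fun_prop)
  have h2 := contDiffOn_const (c := σ) |>.mul (h1.sqrt fun y hy => ne_of_gt hy.2)
  exact (by fun_prop : ContDiffOn ℝ ∞ (fun x : Phase => x.1) _).prodMk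
    (h2.prodMk (by fun_prop : ContDiffOn ℝ ∞ (fun x : Phase => x.2.2) _))

end chart

/-! ### Derivatives at the equilibria -/

theorem Positive.hasFDerivAt_firstIntegral (hp : p.Positive) (v₀ : ℝ) :
    ∃ D : Phase →L[ℝ] ℝ, HasFDerivAt (p.firstIntegral h C) D (0, v₀, 0, 0) ∧
      ∀ e, D e = 2 * p.V 0 * e.1 - 2 * v₀ * e.2.1 := by
  let P : Phase := (0, v₀, 0, 0)
  have hid : HasFDerivAt (fun x : Phase => x) (.id ℝ Phase) P := hasFDerivAt_id P
  have hr : HasFDerivAt (fun x : Phase => x.1) _ P := (hid.fst :)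
  have hv : HasFDerivAt (fun x : Phase => x.2.1) _ P := (hid.snd.fst :)
  have hθ : HasFDerivAt (fun x : Phase => x.2.2.1) _ P := (hid.snd.snd.fst :)
  have hw : HasFDerivAt (fun x : Phase => x.2.2.2) _ P := (hid.snd.snd.snd :)
  have hV := (hp.hasDerivAt_V zero_mem_Ioo_pi).comp_hasFDerivAt_of_eq P hθ rfl
  have hUd := hp.hasDerivAt_U zero_mem_Ioo_pi
  have hf : HasDerivAt (fun θ => (2 * p.U θ - C ^ 2) / Real.cos θ ^ 2) 0 0 := by
    refine (((hUd.const_mul 2).sub_const (C ^ 2)).div ((Real.hasDerivAt_cos 0).pow 2)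
      (by simp)).congr_deriv ?_
    simp [deriv_U_zero]
  have hf' := hf.comp_hasFDerivAt_of_eq P hθ rfl
  have hg := ((hUd.div ((Real.hasDerivAt_cos 0).pow 4) (by simp))).comp_hasFDerivAt_of_eq P hθ rfl
  refine ⟨_, ((((hr.pow 2).const_mul (2 * h)).add ((hr.const_mul 2).mul hV)).add hf').sub
    ((hw.pow 2).mul hg) |>.sub (hv.pow 2), fun e => ?_⟩
  simp [P]
  ring

theorem hasFDerivAt_F {v₀ : ℝ} {D : Phase →L[ℝ] ℝ}
    (hD : HasFDerivAt (p.firstIntegral h C) D (0, v₀, 0, 0))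
    (h0 : p.firstIntegral h C (0, v₀, 0, 0) = 0) : HasFDerivAt (p.F h C) D (0, v₀, 0, 0) := by
  have hid : HasFDerivAt (fun x : Phase => x) (.id ℝ Phase) (0, v₀, 0, 0) := hasFDerivAt_id _
  have hθ : HasFDerivAt (fun x : Phase => x.2.2.1) _ ((0, v₀, 0, 0) : Phase) :=
    (hid.snd.snd.fst :)
  have hc := (hD.mul (((Real.hasDerivAt_cos 0).pow 4).comp_hasFDerivAt_of_eq _ hθ rfl))
  have h1 := hc.congr_of_eventuallyEq (f₁ := p.F h C) (by
    filter_upwards [isOpen_domain.mem_nhds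
      (show ((0, v₀, 0, 0) : Phase) ∈ domain from zero_mem_Ioo_pi)] with x hx
    rw [F_eq hx]
    rfl)
  refine h1.congr_fderiv ?_
  ext <;> simp [h0]

theorem Positive.hasFDerivAt_field (hp : p.Positive) (h C v₀ : ℝ) :
    ∃ D : Phase →L[ℝ] Phase, HasFDerivAt (p.field h C) D (0, v₀, 0, 0) ∧
      ∀ e, D e = (v₀ / √(p.U 0) * e.1, p.V 0 / √(p.U 0) * e.1, e.2.2.2,
        -p.freqSq C * e.2.2.1) := by
  let P : Phase := (0, v₀, 0, 0)
  have hU0 : 0 < p.U 0 := hp.U_pos (by simp)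
  have hid : HasFDerivAt (fun x : Phase => x) (.id ℝ Phase) P := hasFDerivAt_id P
  have hr : HasFDerivAt (fun x : Phase => x.1) _ P := (hid.fst :)
  have hv : HasFDerivAt (fun x : Phase => x.2.1) _ P := (hid.snd.fst :)
  have hθ : HasFDerivAt (fun x : Phase => x.2.2.1) _ P := (hid.snd.snd.fst :)
  have hw : HasFDerivAt (fun x : Phase => x.2.2.2) _ P := (hid.snd.snd.snd :)
  have hV := (hp.hasDerivAt_V zero_mem_Ioo_pi).comp_hasFDerivAt_of_eq P hθ rfl
  have hUd := hp.hasDerivAt_U zero_mem_Ioo_pi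
  have hcos := Real.hasDerivAt_cos 0
  have hsin := Real.hasDerivAt_sin 0
  have hA := ((hcos.pow 2).div (hUd.sqrt hU0.ne')
    (Real.sqrt_pos.2 hU0).ne').comp_hasFDerivAt_of_eq P hθ rfl
  have hk := (hcos.div hUd hU0.ne').comp_hasFDerivAt_of_eq P hθ rfl
  have hV' := (hp.hasDerivAt_deriv_V_zero).comp_hasFDerivAt_of_eq P hθ rfl
  have hc3 := (hcos.pow 3).comp_hasFDerivAt_of_eq P hθ rfl
  have hg := ((hp.hasDerivAt_deriv_U_zero).mul hcos).comp_hasFDerivAt_of_eq P hθ rfl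
  have hg' := (((hUd.const_mul 2).const_sub (C ^ 2)).mul hsin).comp_hasFDerivAt_of_eq P hθ rfl
  have hq := (((Real.hasDerivAt_tan (x := 0) (by simp)).const_mul 2).add
    (hp.hasDerivAt_deriv_U_zero.div (hUd.const_mul 2)
      (by positivity))).comp_hasFDerivAt_of_eq P hθ rfl
  refine ⟨_, ((hA.mul hr).mul hv).prodMk ((((hr.mul ((hr.const_mul (2 * h)).add hV))).mul hA).prodMk
    (hw.prodMk ((hk.mul ((((hr.mul hV').mul hc3).add hg).sub hg')).sub (hq.mul (hw.pow 2))))),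
    fun e => ?_⟩
  refine Prod.ext ?_ (Prod.ext ?_ (Prod.ext ?_ ?_))
  · simp [P]; ring
  · simp [P]; ring
  · simp
  · simp [P, deriv_U_zero, deriv_V_zero, freqSq]; field_simp; ring

/-! ### Homothetic orbits -/

theorem field_of_theta_eq_zero (r v : ℝ) : p.field h C (r, v, 0, 0) =
    (1 / √(p.U 0) * r * v, r * (2 * h * r + p.V 0) * (1 / √(p.U 0)), 0, 0) := by
  simp [field, deriv_V_zero, deriv_U_zero]

theorem firstIntegral_of_theta_eq_zero (r v : ℝ) : p.firstIntegral h C (r, v, 0, 0) =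
    2 * h * r ^ 2 + 2 * r * p.V 0 + (2 * p.U 0 - C ^ 2) - v ^ 2 := by
  simp [firstIntegral, speedSq]

theorem mem_energyLevel_of_theta_eq_zero {r v : ℝ} : (r, v, 0, 0) ∈ p.energyLevel h C ↔
    v ^ 2 = 2 * h * r ^ 2 + 2 * r * p.V 0 + (2 * p.U 0 - C ^ 2) := by
  rw [mem_energyLevel, firstIntegral_of_theta_eq_zero, sub_eq_zero, eq_comm (a := v ^ 2)]
  exact and_iff_right zero_mem_Ioo_pi

/-- The curve of the homothetic orbits (`θ = w = 0`) through `(0, v₀, 0, 0)`, with a parameter `y`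
in which the flow is `y ↦ y exp (λ t)`. In terms of `ρ = 1 / r` the homothetic equation is
`ρ'² = λ² (ρ² + 2 α ρ + 2 h / v₀²)`, so that `ρ` satisfies a linear equation and is a combination of
`exp (-λ t)`, `1` and `exp (λ t)`. -/
noncomputable def homotheticCurve (α β v₀ y : ℝ) : Phase :=
  (y / (1 - α * y + β * y ^ 2), v₀ * (1 - β * y ^ 2) / (1 - α * y + β * y ^ 2), 0, 0)

theorem homotheticCurve_zero (α β v₀ : ℝ) : homotheticCurve α β v₀ 0 = (0, v₀, 0, 0) := by
  simp [homotheticCurve]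

variable {α β v₀ : ℝ}

theorem homotheticCurve_mem_energyLevel (hα : p.V 0 = α * v₀ ^ 2)
    (hβ : 2 * h = (α ^ 2 - 4 * β) * v₀ ^ 2) (hv₀ : v₀ ^ 2 = 2 * p.U 0 - C ^ 2) {y : ℝ}
    (hy : 1 - α * y + β * y ^ 2 ≠ 0) : homotheticCurve α β v₀ y ∈ p.energyLevel h C := by
  refine mem_energyLevel_of_theta_eq_zero.2 ?_
  rw [← hv₀, hα, hβ]
  obtain ⟨D, hD⟩ : ∃ D, D = 1 - α * y + β * y ^ 2 := ⟨_, rfl⟩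
  rw [← hD] at hy ⊢
  field_simp
  rw [hD]
  ring

theorem hasDerivAt_homotheticCurve {z : ℝ} (hz : 1 - α * z + β * z ^ 2 ≠ 0) :
    HasDerivAt (homotheticCurve α β v₀) ((1 - β * z ^ 2) / (1 - α * z + β * z ^ 2) ^ 2,
      v₀ * (α - 4 * β * z + α * β * z ^ 2) / (1 - α * z + β * z ^ 2) ^ 2, 0, 0) z := by
  have hsq : HasDerivAt (fun z : ℝ => z ^ 2) (2 * z) z := by simpa using hasDerivAt_pow 2 z
  have hD : HasDerivAt (fun z : ℝ => 1 - α * z + β * z ^ 2) (-α + β * (2 * z)) z := by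
    simpa [Pi.add_def] using (((hasDerivAt_id z).const_mul α).const_sub 1).add (hsq.const_mul β)
  have h1 := (hasDerivAt_id z).div hD hz
  have h2 := (((hsq.const_mul β).const_sub 1).const_mul v₀).div hD hz
  refine (h1.prodMk (h2.prodMk (hasDerivAt_const z ((0, 0) : ℝ × ℝ)))).congr_deriv ?_
  refine Prod.ext ?_ (Prod.ext ?_ rfl)
  · simp only [id]; ring
  · simp only; ring

theorem isIntegralCurve_homotheticCurve (hα : p.V 0 = α * v₀ ^ 2)
    (hβ : 2 * h = (α ^ 2 - 4 * β) * v₀ ^ 2) (y : ℝ) {t : ℝ}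
    (hy : 1 - α * (y * Real.exp (v₀ / √(p.U 0) * t)) +
      β * (y * Real.exp (v₀ / √(p.U 0) * t)) ^ 2 ≠ 0) :
    HasDerivAt (fun t => homotheticCurve α β v₀ (y * Real.exp (v₀ / √(p.U 0) * t)))
      (p.field h C (homotheticCurve α β v₀ (y * Real.exp (v₀ / √(p.U 0) * t)))) t := by
  have hz : HasDerivAt (fun t => y * Real.exp (v₀ / √(p.U 0) * t))
      (y * Real.exp (v₀ / √(p.U 0) * t) * (v₀ / √(p.U 0))) t := by
    refine (((hasDerivAt_id t).const_mul (v₀ / √(p.U 0))).exp.const_mul y).congr_deriv ?_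
    simp only [id]
    ring
  refine ((hasDerivAt_homotheticCurve (v₀ := v₀) hy).scomp t hz).congr_deriv ?_
  generalize y * Real.exp (v₀ / √(p.U 0) * t) = z at hz hy
  rw [homotheticCurve, field_of_theta_eq_zero, hα, hβ]
  obtain ⟨D, hD⟩ : ∃ D, D = 1 - α * z + β * z ^ 2 := ⟨_, rfl⟩
  rw [← hD] at hy ⊢
  refine Prod.ext ?_ (Prod.ext ?_ (by simp))
  · simp only [Prod.smul_mk, smul_eq_mul]
    field_simp
  · simp only [Prod.smul_mk, smul_eq_mul]
    field_simp
    rw [hD]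
    ring

/-- The parameter of a point of the homothetic curve, in terms of `r` and `v`. -/
theorem homotheticCurve_param {r v : ℝ} (hv₀ : v₀ ≠ 0)
    (hv : v ^ 2 = ((α ^ 2 - 4 * β) * r ^ 2 + 2 * r * α + 1) * v₀ ^ 2)
    (hq : 1 + α * r + v / v₀ ≠ 0) :
    homotheticCurve α β v₀ (2 * r / (1 + α * r + v / v₀)) = (r, v, 0, 0) := by
  obtain ⟨s, hs⟩ : ∃ s, s = v / v₀ := ⟨_, rfl⟩
  have hvs : v = v₀ * s := by rw [hs]; field_simp
  have hs2 : s ^ 2 = (α ^ 2 - 4 * β) * r ^ 2 + 2 * r * α + 1 := by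
    rw [hs, div_pow, hv]; field_simp
  rw [← hs] at hq ⊢
  obtain ⟨q, hqe⟩ : ∃ q, q = 1 + α * r + s := ⟨_, rfl⟩
  rw [← hqe] at hq ⊢
  have hs' : s = q - 1 - α * r := by rw [hqe]; ring
  have hD : 1 - α * (2 * r / q) + β * (2 * r / q) ^ 2 = 2 / q := by
    field_simp
    rw [hs'] at hs2
    linear_combination hs2
  have hN : 1 - β * (2 * r / q) ^ 2 = 2 * s / q := by
    rw [hs']
    rw [hs'] at hs2
    field_simp
    linear_combination -hs2
  rw [homotheticCurve, hD, hN, hvs]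
  refine Prod.ext ?_ (Prod.ext ?_ rfl) <;> simp only <;> field_simp

/-- Near `(0, v₀, 0, 0)` with `0 < v₀` the homothetic orbits belong to the unstable set. -/
theorem exists_homothetic_subset_localUnstableSet (hp : p.Positive) (hv₀ : 0 < v₀)
    (hsq : v₀ ^ 2 = 2 * p.U 0 - C ^ 2) {O : Set Phase} (hO : O ∈ 𝓝 ((0, v₀, 0, 0) : Phase)) :
    ∃ N : Set Phase, IsOpen N ∧ (0, v₀, 0, 0) ∈ N ∧ N ⊆ O ∧
      {x | x ∈ p.energyLevel h C ∩ N ∧ x.2.2 = 0} ⊆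
        localUnstableSet (p.field h C) (p.energyLevel h C) N (0, v₀, 0, 0) := by
  have hU0 : 0 < p.U 0 := hp.U_pos (by simp)
  set l : ℝ := v₀ / √(p.U 0) with hl
  have hl0 : 0 < l := by positivity
  obtain ⟨α, hα⟩ : ∃ α, p.V 0 = α * v₀ ^ 2 := ⟨p.V 0 / v₀ ^ 2, by field_simp⟩
  obtain ⟨β, hβ⟩ : ∃ β, 2 * h = (α ^ 2 - 4 * β) * v₀ ^ 2 :=
    ⟨(α ^ 2 - 2 * h / v₀ ^ 2) / 4, by field_simp; ring⟩
  obtain ⟨O', hO'O, hO', hPO'⟩ := mem_nhds_iff.1 hO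
  have hcurve : ContinuousAt (homotheticCurve α β v₀) 0 :=
    (hasDerivAt_homotheticCurve (by simp)).continuousAt
  have hDc : ContinuousAt (fun y : ℝ => 1 - α * y + β * y ^ 2) 0 := by fun_prop
  have hev : ∀ᶠ y in 𝓝 (0 : ℝ), homotheticCurve α β v₀ y ∈ O' ∧ 0 < 1 - α * y + β * y ^ 2 :=
    (hcurve.eventually (p := fun x => x ∈ O')
      (by rw [homotheticCurve_zero]; exact hO'.mem_nhds hPO')).and
      (hDc.eventually (lt_mem_nhds (by simp)))
  obtain ⟨ε, hε, hball⟩ := Metric.eventually_nhds_iff.1 hev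
  simp only [dist_zero_right, Real.norm_eq_abs] at hball
  refine ⟨O' ∩ {x | 0 < 1 + α * x.1 + x.2.1 / v₀ ∧
      |2 * x.1| < ε * (1 + α * x.1 + x.2.1 / v₀)}, ?_, ⟨hPO', ?_⟩,
      inter_subset_left.trans hO'O, ?_⟩
  · have h1 : IsOpen {x : Phase | 0 < 1 + α * x.1 + x.2.1 / v₀} :=
      isOpen_lt (by fun_prop) (by fun_prop)
    have h2 : IsOpen {x : Phase | |2 * x.1| < ε * (1 + α * x.1 + x.2.1 / v₀)} :=
      isOpen_lt (by fun_prop) (by fun_prop)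
    exact hO'.inter (h1.inter h2)
  · simp [hv₀.ne']
    positivity
  rintro ⟨r, v, θ, w⟩ ⟨⟨hE, -, hq, hr⟩, h0⟩
  obtain ⟨rfl, rfl⟩ : θ = 0 ∧ w = 0 := by simpa using h0
  simp only at hq hr
  rw [mem_energyLevel_of_theta_eq_zero, ← hsq, hα, hβ] at hE
  set y : ℝ := 2 * r / (1 + α * r + v / v₀) with hy
  have hyε : |y| < ε := by
    rw [hy, abs_div, abs_of_pos hq, div_lt_iff₀ hq]
    exact hr
  have hzε : ∀ t ≤ 0, |y * Real.exp (l * t)| < ε := fun t ht => by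
    have : Real.exp (l * t) ≤ 1 := Real.exp_le_one_iff.2 (by nlinarith)
    rw [abs_mul, Real.abs_exp]
    nlinarith [abs_nonneg y]
  refine ⟨fun t => homotheticCurve α β v₀ (y * Real.exp (l * t)), ?_, ?_, ?_, ?_⟩
  · simp only [mul_zero, Real.exp_zero, mul_one]
    exact homotheticCurve_param hv₀.ne' (by rw [hE]; ring) hq.ne'
  · intro t ht
    exact (isIntegralCurve_homotheticCurve hα hβ y
      (hball (hzε t ht)).2.ne').hasDerivWithinAt
  · intro t ht
    have hz := hzε t ht
    obtain ⟨hzO, hzD⟩ := hball hz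
    refine ⟨homotheticCurve_mem_energyLevel hα hβ hsq hzD.ne', hzO, ?_⟩
    beta_reduce
    generalize y * Real.exp (l * t) = z at hz hzO hzD
    -- on the curve `1 + α r + v / v₀ = 2 / (1 - α y + β y ^ 2)`
    have hq' : 1 + α * (homotheticCurve α β v₀ z).1 + (homotheticCurve α β v₀ z).2.1 / v₀ =
        2 / (1 - α * z + β * z ^ 2) := by
      simp only [homotheticCurve]
      obtain ⟨D, hD⟩ : ∃ D, D = 1 - α * z + β * z ^ 2 := ⟨_, rfl⟩
      rw [← hD] at hzD ⊢
      field_simp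
      rw [hD]
      ring
    change 0 < _ ∧ _ < ε * _
    rw [hq']
    refine ⟨by positivity, ?_⟩
    simp only [homotheticCurve]
    rw [← mul_div_assoc, abs_div, abs_of_pos hzD, abs_mul, abs_two, ← mul_div_assoc]
    exact div_lt_div_of_pos_right (by linarith) hzD
  · have h1 : Tendsto (fun t : ℝ => y * Real.exp (l * t)) atBot (𝓝 0) := by
      simpa using (Real.tendsto_exp_atBot.comp
        (tendsto_id.const_mul_atBot hl0)).const_mul y
    have h2 := hcurve.tendsto.comp h1
    rwa [homotheticCurve_zero] at h2

/-! ### The unstable set -/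

/-- Backward solutions that tend to `(0, v₀, 0, 0)` are homothetic: the energy
`(C² - 2 U) / cos² + w² U / cos⁴` of the motion in `(θ, w)`, which has a nondegenerate minimum at
the equilibrium, changes at the rate `2 r V' w`, and `r` decays exponentially. -/
theorem Positive.exists_localUnstableSet_subset (hp : p.Positive) (h16 : p.γ₀ < 16 * p.γ)
    (hv₀ : 0 < v₀) (hsq : v₀ ^ 2 = 2 * p.U 0 - C ^ 2) :
    ∀ᶠ N in (𝓝 ((0, v₀, 0, 0) : Phase)).smallSets, ∀ S,
      localUnstableSet (p.field h C) S N (0, v₀, 0, 0) ⊆ {x | x.2.2 = 0} := by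
  have hU0 : 0 < p.U 0 := hp.U_pos (by simp)
  obtain ⟨c, hc, hgev⟩ := hp.exists_potential_ge h16 C
  obtain ⟨B, hB, hVev⟩ := hp.exists_abs_deriv_V_le
  have hθ : Tendsto (fun x : Phase => x.2.2.1) (𝓝 (0, v₀, 0, 0)) (𝓝 0) :=
    (by fun_prop : Continuous fun x : Phase => x.2.2.1).tendsto' _ _ rfl
  have hUc := (hp.hasDerivAt_U zero_mem_Ioo_pi).continuousAt
  have hA : ContinuousAt (fun θ => Real.cos θ ^ 2 / √(p.U θ)) 0 :=
    (by fun_prop : ContinuousAt (fun θ => Real.cos θ ^ 2) 0).div hUc.sqrt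
      (Real.sqrt_pos.2 hU0).ne'
  have hUcos : ContinuousAt (fun θ => p.U θ / Real.cos θ ^ 4) 0 :=
    hUc.div (by fun_prop) (by simp)
  have hv : Tendsto (fun x : Phase => x.2.1) (𝓝 (0, v₀, 0, 0)) (𝓝 v₀) :=
    (by fun_prop : Continuous fun x : Phase => x.2.1).tendsto' _ _ rfl
  have hav : ∀ᶠ x : Phase in 𝓝 (0, v₀, 0, 0),
      1 / √(p.U 0) * v₀ / 2 < Real.cos x.2.2.1 ^ 2 / √(p.U x.2.2.1) * x.2.1 :=
    ((hA.tendsto.comp hθ).mul hv).eventually (lt_mem_nhds (by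
      simp only [Real.cos_zero, one_pow]
      exact half_lt_self (by positivity)))
  have hUev : ∀ᶠ θ in 𝓝 (0 : ℝ), p.U 0 / 2 < p.U θ / Real.cos θ ^ 4 :=
    hUcos.eventually (lt_mem_nhds (by simpa using hU0))
  have hev : {x : Phase | x ∈ domain ∧
      1 / √(p.U 0) * v₀ / 2 < Real.cos x.2.2.1 ^ 2 / √(p.U x.2.2.1) * x.2.1 ∧
      c * x.2.2.1 ^ 2 ≤ 2 * p.U 0 - C ^ 2 - (2 * p.U x.2.2.1 - C ^ 2) / Real.cos x.2.2.1 ^ 2 ∧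
      |deriv p.V x.2.2.1| ≤ B * |x.2.2.1| ∧
      p.U 0 / 2 < p.U x.2.2.1 / Real.cos x.2.2.1 ^ 4} ∈ 𝓝 ((0, v₀, 0, 0) : Phase) := by
    filter_upwards [isOpen_domain.mem_nhds (show ((0, v₀, 0, 0) : Phase) ∈ domain from
      zero_mem_Ioo_pi), hav, hθ.eventually hgev, hθ.eventually hVev, hθ.eventually hUev]
      with x h1 h2 h3 h4 h5
    exact ⟨h1, h2, h3, h4, h5⟩
  filter_upwards [eventually_smallSets.2 ⟨_, hev, fun N hN => hN⟩] with N hN S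
  rintro x ⟨γ, rfl, hγ, hmem, hlim⟩
  -- the energy of the motion in `(θ, w)`
  let Kf : Phase → ℝ := fun x => v₀ ^ 2 - p.speedSq h C x + 2 * h * x.1 ^ 2 +
    2 * x.1 * p.V x.2.2.1
  have hKf : ∀ x : Phase, Kf x = 2 * p.U 0 - C ^ 2 -
      (2 * p.U x.2.2.1 - C ^ 2) / Real.cos x.2.2.1 ^ 2 +
      p.U x.2.2.1 / Real.cos x.2.2.1 ^ 4 * x.2.2.2 ^ 2 := fun x => by
    simp only [Kf, speedSq, hsq]
    ring
  set c' : ℝ := min c (p.U 0 / 2) with hc'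
  have hc'0 : 0 < c' := lt_min hc (by positivity)
  have hge : ∀ t ≤ 0, c' * ((γ t).2.2.1 ^ 2 + (γ t).2.2.2 ^ 2) ≤ Kf (γ t) := fun t ht => by
    obtain ⟨-, -, h3, -, h5⟩ := hN (hmem t ht).2
    have i1 : c' * (γ t).2.2.1 ^ 2 ≤ c * (γ t).2.2.1 ^ 2 :=
      mul_le_mul_of_nonneg_right (min_le_left _ _) (sq_nonneg _)
    have i2 : c' * (γ t).2.2.2 ^ 2 ≤ p.U (γ t).2.2.1 / Real.cos (γ t).2.2.1 ^ 4 *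
        (γ t).2.2.2 ^ 2 :=
      mul_le_mul_of_nonneg_right ((min_le_right _ _).trans h5.le) (sq_nonneg _)
    rw [hKf, mul_add]
    linarith
  have hr : ∀ t ≤ 0, HasDerivWithinAt (fun t => (γ t).1)
      (Real.cos (γ t).2.2.1 ^ 2 / √(p.U (γ t).2.2.1) * (γ t).2.1 * (γ t).1) (Iic 0) t :=
    fun t ht => by
      have h1 : HasDerivWithinAt (fun t => (γ t).1) _ (Iic 0) t :=
        (hγ t ht).hasFDerivWithinAt.fst.hasDerivWithinAt
      refine h1.congr_deriv ?_
      simp [field]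
      ring
  have hK : ∀ t ≤ 0, HasDerivWithinAt (fun t => Kf (γ t))
      (2 * (γ t).1 * deriv p.V (γ t).2.2.1 * (γ t).2.2.2) (Iic 0) t := fun t ht => by
    have hd := (hN (hmem t ht).2).1
    have hθ' : HasDerivWithinAt (fun t => (γ t).2.2.1) _ (Iic 0) t :=
      (hγ t ht).hasFDerivWithinAt.snd.snd.fst.hasDerivWithinAt
    have hV := (hp.hasDerivAt_V hd).comp_hasDerivWithinAt t hθ'
    refine ((((hp.hasDerivWithinAt_speedSq (hγ t ht) hd).const_sub (v₀ ^ 2)).add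
      (((hr t ht).pow 2).const_mul (2 * h))).add
      (((hr t ht).const_mul 2).mul hV)).congr_deriv ?_
    simp [field]
    ring
  have hKlim : Tendsto (fun t => Kf (γ t)) atBot (𝓝 0) := by
    have hP : ((0, v₀, 0, 0) : Phase) ∈ domain := zero_mem_Ioo_pi
    have hs : ContinuousAt (p.speedSq h C) (0, v₀, 0, 0) :=
      (hp.contDiffOn_speedSq.contDiffAt (isOpen_domain.mem_nhds hP)).continuousAt
    have hV : ContinuousAt (fun x : Phase => p.V x.2.2.1) (0, v₀, 0, 0) :=
      (hp.hasDerivAt_V zero_mem_Ioo_pi).continuousAt.tendsto.comp hθ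
    have hcont : ContinuousAt Kf (0, v₀, 0, 0) := by fun_prop
    have h0 : Kf (0, v₀, 0, 0) = 0 := by rw [hKf]; simp
    have := hcont.tendsto.comp hlim
    rwa [h0] at this
  have hrate : ∀ t ≤ 0, 2 * (γ t).1 * deriv p.V (γ t).2.2.1 * (γ t).2.2.2 ≤
      B / c' * |(γ t).1| * Kf (γ t) := fun t ht => by
    obtain ⟨-, -, -, h4, -⟩ := hN (hmem t ht).2
    have i1 := hge t ht
    calc 2 * (γ t).1 * deriv p.V (γ t).2.2.1 * (γ t).2.2.2
        ≤ 2 * |(γ t).1| * |deriv p.V (γ t).2.2.1| * |(γ t).2.2.2| := by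
          refine (le_abs_self _).trans_eq ?_
          simp [abs_mul]
      _ ≤ 2 * |(γ t).1| * (B * |(γ t).2.2.1|) * |(γ t).2.2.2| := by gcongr
      _ = B * |(γ t).1| * (2 * |(γ t).2.2.1| * |(γ t).2.2.2|) := by ring
      _ ≤ B * |(γ t).1| * ((γ t).2.2.1 ^ 2 + (γ t).2.2.2 ^ 2) := by
          gcongr
          simpa using two_mul_le_add_sq |(γ t).2.2.1| |(γ t).2.2.2|
      _ = B / c' * |(γ t).1| * (c' * ((γ t).2.2.1 ^ 2 + (γ t).2.2.2 ^ 2)) := by field_simp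
      _ ≤ _ := by gcongr
  have hfin : Kf (γ 0) ≤ 0 := nonpos_of_tendsto_atBot (l := 1 / √(p.U 0) * v₀ / 2)
    (by positivity) (by positivity) hr (fun t ht => (hN (hmem t ht).2).2.1.le) hK hrate
    (fun t ht => le_trans (by positivity) (hge t ht)) hKlim
  have hsum : (γ 0).2.2.1 ^ 2 + (γ 0).2.2.2 ^ 2 ≤ 0 := by
    by_contra! hpos
    nlinarith [mul_pos hc'0 hpos, hge 0 le_rfl]
  refine Prod.ext ?_ ?_
  · exact pow_eq_zero_iff two_ne_zero |>.1
      (by nlinarith [sq_nonneg (γ 0).2.2.1, sq_nonneg (γ 0).2.2.2])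
  · exact pow_eq_zero_iff two_ne_zero |>.1
      (by nlinarith [sq_nonneg (γ 0).2.2.1, sq_nonneg (γ 0).2.2.2])

theorem Positive.exists_localUnstableSet_eq (hp : p.Positive) (h16 : p.γ₀ < 16 * p.γ)
    (hv₀ : 0 < v₀) (hsq : v₀ ^ 2 = 2 * p.U 0 - C ^ 2) {O : Set Phase}
    (hO : O ∈ 𝓝 ((0, v₀, 0, 0) : Phase)) :
    ∃ N : Set Phase, IsOpen N ∧ (0, v₀, 0, 0) ∈ N ∧ N ⊆ O ∧
      localUnstableSet (p.field h C) (p.energyLevel h C) N (0, v₀, 0, 0) =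
        {x | x ∈ p.energyLevel h C ∩ N ∧ x.2.2 = 0} := by
  obtain ⟨O₁, hO₁, h1⟩ := eventually_smallSets.1
    (hp.exists_localUnstableSet_subset (h := h) h16 hv₀ hsq)
  obtain ⟨N, hN, hPN, hNO, hsub⟩ := exists_homothetic_subset_localUnstableSet (h := h) hp hv₀ hsq
    (inter_mem hO hO₁)
  refine ⟨N, hN, hPN, hNO.trans inter_subset_left, Subset.antisymm (fun x hx => ⟨?_, ?_⟩) hsub⟩
  · obtain ⟨γ, rfl, -, hm, -⟩ := hx
    exact hm 0 le_rfl
  · exact h1 N (hNO.trans inter_subset_right) _ hx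

/-- The time reversal `(r, v, θ, w) ↦ (r, -v, θ, -w)`. -/
noncomputable def reversal : Phase →L[ℝ] Phase :=
  (ContinuousLinearMap.fst ℝ ℝ (ℝ × ℝ × ℝ)).prod
    ((-(ContinuousLinearMap.fst ℝ ℝ (ℝ × ℝ)).comp (.snd ℝ ℝ (ℝ × ℝ × ℝ))).prod
      (((ContinuousLinearMap.fst ℝ ℝ ℝ).prod (-(ContinuousLinearMap.snd ℝ ℝ ℝ))).comp
        ((ContinuousLinearMap.snd ℝ ℝ (ℝ × ℝ)).comp (.snd ℝ ℝ (ℝ × ℝ × ℝ)))))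

theorem reversal_apply (x : Phase) : reversal x = (x.1, -x.2.1, x.2.2.1, -x.2.2.2) := rfl

theorem field_reversal (x : Phase) : p.field h C (reversal x) = -reversal (p.field h C x) := by
  simp [reversal_apply, field]

theorem Positive.exists_localStableSet_eq (hp : p.Positive) (h16 : p.γ₀ < 16 * p.γ)
    (hv₀ : v₀ < 0) (hsq : v₀ ^ 2 = 2 * p.U 0 - C ^ 2) {O : Set Phase}
    (hO : O ∈ 𝓝 ((0, v₀, 0, 0) : Phase)) :
    ∃ N : Set Phase, IsOpen N ∧ (0, v₀, 0, 0) ∈ N ∧ N ⊆ O ∧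
      localStableSet (p.field h C) (p.energyLevel h C) N (0, v₀, 0, 0) =
        {x | x ∈ p.energyLevel h C ∩ N ∧ x.2.2 = 0} := by
  have hρρ : ∀ x : Phase, reversal (reversal x) = x := fun x => by simp [reversal_apply]
  have hρP : ∀ v : ℝ, reversal (0, v, 0, 0) = (0, -v, 0, 0) := fun v => by simp [reversal_apply]
  have hE : ∀ x : Phase, reversal x ∈ p.energyLevel h C ↔ x ∈ p.energyLevel h C := fun x => by
    simp [energyLevel, F, domain, reversal_apply]
  have hO' : reversal ⁻¹' O ∈ 𝓝 ((0, -v₀, 0, 0) : Phase) :=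
    reversal.continuous.continuousAt.preimage_mem_nhds (by rwa [hρP, neg_neg])
  obtain ⟨N, hN, hPN, hNO, heq⟩ := hp.exists_localUnstableSet_eq (h := h) (C := C) h16
    (neg_pos.2 hv₀) (by rw [neg_sq, hsq]) hO'
  refine ⟨reversal ⁻¹' N, hN.preimage reversal.continuous, by rwa [mem_preimage, hρP],
    fun x hx => by simpa [hρρ] using hNO hx, ?_⟩
  have h1 := localStableSet_eq_preimage_of_reversal reversal hρρ
    (field_reversal (p := p) (h := h) (C := C)) (p.energyLevel h C) N (0, v₀, 0, 0)
  rw [show reversal ⁻¹' p.energyLevel h C = p.energyLevel h C from ext hE, hρP, heq] at h1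
  rw [h1]
  ext x
  simp only [mem_preimage, mem_ofPred_eq, mem_inter_iff, hE]
  simp [reversal_apply, Prod.ext_iff]

/-! ### The linearization on the tangent space of the energy level -/

theorem Positive.mem_tangentSpace (hp : p.Positive) (hsq : v₀ ^ 2 = 2 * p.U 0 - C ^ 2)
    (x : Phase) : x ∈ p.tangentSpace h C (0, v₀, 0, 0) ↔ v₀ * x.2.1 = p.V 0 * x.1 := by
  obtain ⟨D, hD, hDe⟩ := hp.hasFDerivAt_firstIntegral (h := h) (C := C) v₀
  have hF := hasFDerivAt_F hD (by rw [firstIntegral_of_theta_eq_zero, hsq]; simp)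
  rw [tangentSpace, hF.fderiv, LinearMap.mem_ker, ContinuousLinearMap.coe_coe, hDe]
  constructor <;> intro hx <;> linarith

theorem Positive.linearization_apply (hp : p.Positive) (x : Phase) :
    p.linearization h C (0, v₀, 0, 0) x = (v₀ / √(p.U 0) * x.1, p.V 0 / √(p.U 0) * x.1,
      x.2.2.2, -p.freqSq C * x.2.2.1) := by
  obtain ⟨D, hD, hDe⟩ := hp.hasFDerivAt_field h C v₀
  rw [linearization, hD.fderiv, ContinuousLinearMap.coe_coe, hDe]

theorem Positive.linearization_mem (hp : p.Positive) (hsq : v₀ ^ 2 = 2 * p.U 0 - C ^ 2) :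
    ∀ x ∈ p.tangentSpace h C (0, v₀, 0, 0),
      p.linearization h C (0, v₀, 0, 0) x ∈ p.tangentSpace h C (0, v₀, 0, 0) := fun x _ => by
  rw [hp.mem_tangentSpace hsq, hp.linearization_apply]
  ring

/-- The coordinates `r`, `θ`, `w` on the tangent space of the energy level. -/
noncomputable def tangentCoord (hp : p.Positive) (h : ℝ) (hv₀ : v₀ ≠ 0)
    (hsq : v₀ ^ 2 = 2 * p.U 0 - C ^ 2) :
    p.tangentSpace h C (0, v₀, 0, 0) ≃ₗ[ℝ] (Fin 3 → ℝ) where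
  toFun x := ![x.1.1, x.1.2.2.1, x.1.2.2.2]
  map_add' x y := by ext i; fin_cases i <;> rfl
  map_smul' a x := by ext i; fin_cases i <;> rfl
  invFun f := ⟨(f 0, p.V 0 * f 0 / v₀, f 1, f 2), by
    rw [hp.mem_tangentSpace hsq]; simp only; field_simp⟩
  left_inv x := by
    have hx := (hp.mem_tangentSpace hsq x.1).1 x.2
    refine Subtype.ext (Prod.ext rfl (Prod.ext ?_ rfl))
    change p.V 0 * x.1.1 / v₀ = x.1.2.1
    rw [← hx]
    field_simp
  right_inv f := by ext i; fin_cases i <;> rfl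

theorem tangentCoord_apply (hp : p.Positive) (hv₀ : v₀ ≠ 0) (hsq : v₀ ^ 2 = 2 * p.U 0 - C ^ 2)
    (x : p.tangentSpace h C (0, v₀, 0, 0)) :
    tangentCoord hp h hv₀ hsq x = ![x.1.1, x.1.2.2.1, x.1.2.2.2] := rfl

theorem Positive.tangentCoord_restrict (hp : p.Positive) (h16 : p.γ₀ < 16 * p.γ) (hv₀ : v₀ ≠ 0)
    (hsq : v₀ ^ 2 = 2 * p.U 0 - C ^ 2)
    (hJ : ∀ x ∈ p.tangentSpace h C (0, v₀, 0, 0),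
      p.linearization h C (0, v₀, 0, 0) x ∈ p.tangentSpace h C (0, v₀, 0, 0))
    (x : p.tangentSpace h C (0, v₀, 0, 0)) :
    tangentCoord hp h hv₀ hsq ((p.linearization h C (0, v₀, 0, 0)).restrict hJ x) =
      ![v₀ / √(p.U 0) * tangentCoord hp h hv₀ hsq x 0, tangentCoord hp h hv₀ hsq x 2,
        -√(p.freqSq C) ^ 2 * tangentCoord hp h hv₀ hsq x 1] := by
  rw [Real.sq_sqrt (hp.freqSq_pos h16 C).le, tangentCoord_apply, LinearMap.coe_restrict_apply,
    hp.linearization_apply]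
  rfl

/-! ### The invariant manifolds in the chart -/

theorem finrank_ker_phase {V : Type*} [AddCommGroup V] [Module ℝ V] {f : Phase →ₗ[ℝ] V}
    (hf : Function.Surjective f) :
    Module.finrank ℝ V + Module.finrank ℝ (LinearMap.ker f) = 4 := by
  have h1 := f.finrank_range_add_finrank_ker
  rw [LinearMap.range_eq_top.2 hf, finrank_top] at h1
  simpa using h1

/-- The coordinate subspace `F = 0` of the chart. -/
noncomputable def flatLevel : Submodule ℝ Phase :=
  LinearMap.ker ((LinearMap.fst ℝ ℝ (ℝ × ℝ)).comp (LinearMap.snd ℝ ℝ (ℝ × ℝ × ℝ)))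

/-- The coordinate subspace `F = θ = w = 0` of the chart. -/
noncomputable def flatHomothetic : Submodule ℝ Phase :=
  LinearMap.ker (LinearMap.snd ℝ ℝ (ℝ × ℝ × ℝ))

/-- The coordinate subspace `r = F = 0` of the chart. -/
noncomputable def flatCollision : Submodule ℝ Phase :=
  LinearMap.ker ((LinearMap.fst ℝ ℝ (ℝ × ℝ × ℝ)).prod
    ((LinearMap.fst ℝ ℝ (ℝ × ℝ)).comp (LinearMap.snd ℝ ℝ (ℝ × ℝ × ℝ))))

theorem mem_flatLevel (x : Phase) : x ∈ flatLevel ↔ x.2.1 = 0 := Iff.rfl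

theorem mem_flatHomothetic (x : Phase) : x ∈ flatHomothetic ↔ x.2.1 = 0 ∧ x.2.2 = 0 := by
  simp [flatHomothetic, Prod.ext_iff]

theorem mem_flatCollision (x : Phase) : x ∈ flatCollision ↔ x.1 = 0 ∧ x.2.1 = 0 := by
  simp [flatCollision]

theorem finrank_flatLevel : Module.finrank ℝ flatLevel = 3 := by
  have := finrank_ker_phase (f := (LinearMap.fst ℝ ℝ (ℝ × ℝ)).comp (LinearMap.snd ℝ ℝ (ℝ × ℝ × ℝ)))
    (fun a => ⟨(0, a, 0, 0), rfl⟩)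
  simp only [Module.finrank_self] at this
  unfold flatLevel
  omega

theorem finrank_flatHomothetic : Module.finrank ℝ flatHomothetic = 1 := by
  have := finrank_ker_phase (f := LinearMap.snd ℝ ℝ (ℝ × ℝ × ℝ)) LinearMap.snd_surjective
  simp only [Module.finrank_prod, Module.finrank_self] at this
  unfold flatHomothetic
  omega

theorem finrank_flatCollision : Module.finrank ℝ flatCollision = 2 := by
  have := finrank_ker_phase (f := (LinearMap.fst ℝ ℝ (ℝ × ℝ × ℝ)).prod
    ((LinearMap.fst ℝ ℝ (ℝ × ℝ)).comp (LinearMap.snd ℝ ℝ (ℝ × ℝ × ℝ))))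
    (fun a => ⟨(a.1, a.2, 0, 0), rfl⟩)
  simp only [Module.finrank_prod, Module.finrank_self] at this
  unfold flatCollision
  omega

/-! ### The invariant manifolds at the equilibria -/

theorem Positive.tangentVectors_eq (hp : p.Positive) {σ : ℝ} (hσ : σ * σ = 1)
    (hσv : 0 < σ * v₀) {S N : Set Phase} (L : Submodule ℝ Phase) (hN : IsOpen N)
    (hPN : (0, v₀, 0, 0) ∈ N) (hPS : (0, v₀, 0, 0) ∈ S)
    (hS : ∀ y ∈ (chart hp h C hσ).source, y ∈ N → (y ∈ S ↔ chart hp h C hσ y ∈ L)) :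
    tangentVectors S (0, v₀, 0, 0) =
      {e : Phase | (e.1, 2 * p.V 0 * e.1 - 2 * v₀ * e.2.1, e.2.2) ∈ L} := by
  obtain ⟨D, hD, hDe⟩ := hp.hasFDerivAt_firstIntegral (h := h) (C := C) v₀
  have hid : HasFDerivAt (fun x : Phase => x) (.id ℝ Phase) (0, v₀, 0, 0) := hasFDerivAt_id _
  have hφ : HasFDerivAt (chart hp h C hσ) _ (0, v₀, 0, 0) :=
    hid.fst.prodMk (hD.prodMk hid.snd.snd)
  rw [tangentVectors_of_chart (chart hp h C hσ) L (contDiffOn_chart_symm hp hσ) hN hPN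
    ⟨zero_mem_Ioo_pi, hσv⟩ hPS hS hφ]
  ext e
  simp [hDe]

theorem mem_energyLevel_equilibrium (hsq : v₀ ^ 2 = 2 * p.U 0 - C ^ 2) :
    ((0, v₀, 0, 0) : Phase) ∈ p.energyLevel h C :=
  mem_energyLevel_of_theta_eq_zero.2 (by rw [hsq]; ring)

theorem mem_energyLevel_iff_chart (hp : p.Positive) {σ : ℝ} (hσ : σ * σ = 1) :
    ∀ y ∈ (chart hp h C hσ).source, y ∈ p.energyLevel h C ↔ (chart hp h C hσ y).2.1 = 0 :=
  fun _ hy => mem_energyLevel.trans (and_iff_right hy.1)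

theorem Positive.isRegularCollisionEquilibrium (hp : p.Positive) {σ : ℝ} (hσ : σ * σ = 1)
    (hσv : 0 < σ * v₀) (hsq : v₀ ^ 2 = 2 * p.U 0 - C ^ 2) :
    p.IsRegularCollisionEquilibrium h C (0, v₀, 0, 0) := by
  have hU0 : 0 < p.U 0 := hp.U_pos (by simp)
  have hv₀ : v₀ ≠ 0 := fun h0 => by simp [h0] at hσv
  have hE := mem_energyLevel_equilibrium (h := h) hsq
  refine ⟨hp.isLocallyInvariant_energyLevel, hE, ⟨zero_mem_Ioo_pi, rfl, ?_⟩, ?_,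
    ⟨(chart hp h C hσ).source, (chart hp h C hσ).open_source, ⟨zero_mem_Ioo_pi, hσv⟩, ?_⟩, ?_, ?_⟩
  · simp only [hsq, Real.cos_zero]
    ring
  · simp [field_of_theta_eq_zero]
  · refine isSmoothSubmanifold_of_chart (chart hp h C hσ) flatLevel finrank_flatLevel
      (contDiffOn_chart hp hσ) (contDiffOn_chart_symm hp hσ) isOpen_univ inter_subset_right
      (subset_univ _) fun y hy _ => ?_
    rw [mem_flatLevel, ← mem_energyLevel_iff_chart hp hσ y hy]
    exact and_iff_left hy
  · rw [(tangentCoord hp h hv₀ hsq).finrank_eq]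
    simp
  · rw [hp.tangentVectors_eq hσ hσv flatLevel isOpen_univ (mem_univ _) hE
      fun y hy _ => mem_energyLevel_iff_chart hp hσ y hy]
    ext e
    rw [SetLike.mem_coe, hp.mem_tangentSpace hsq]
    change 2 * p.V 0 * e.1 - 2 * v₀ * e.2.1 = 0 ↔ _
    constructor <;> intro he <;> linarith

theorem isSmoothSubmanifold_homothetic (hp : p.Positive) {σ : ℝ} (hσ : σ * σ = 1)
    {N : Set Phase} (hN : IsOpen N) (hNφ : N ⊆ (chart hp h C hσ).source) :
    IsSmoothSubmanifold 1 {x | x ∈ p.energyLevel h C ∩ N ∧ x.2.2 = 0} := by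
  refine isSmoothSubmanifold_of_chart (chart hp h C hσ) flatHomothetic finrank_flatHomothetic
    (contDiffOn_chart hp hσ) (contDiffOn_chart_symm hp hσ) hN (fun x hx => hNφ hx.1.2)
    (fun x hx => hx.1.2) fun y hy hyN => ?_
  rw [mem_flatHomothetic, ← mem_energyLevel_iff_chart hp hσ y hy]
  exact and_congr_left fun _ => and_iff_left hyN

theorem Positive.tangentVectors_homothetic (hp : p.Positive) {σ : ℝ} (hσ : σ * σ = 1)
    (hσv : 0 < σ * v₀) (hsq : v₀ ^ 2 = 2 * p.U 0 - C ^ 2) {N : Set Phase} (hN : IsOpen N)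
    (hPN : (0, v₀, 0, 0) ∈ N) :
    tangentVectors {x | x ∈ p.energyLevel h C ∩ N ∧ x.2.2 = 0} (0, v₀, 0, 0) =
      {e | v₀ * e.2.1 = p.V 0 * e.1 ∧ e.2.2 = 0} := by
  have hPS : ((0, v₀, 0, 0) : Phase) ∈ {x | x ∈ p.energyLevel h C ∩ N ∧ x.2.2 = 0} :=
    ⟨⟨mem_energyLevel_equilibrium hsq, hPN⟩, rfl⟩
  rw [hp.tangentVectors_eq (h := h) (C := C) hσ hσv flatHomothetic hN hPN hPS
    fun y hy hyN => ?_]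
  · ext e
    refine (mem_flatHomothetic _).trans (and_congr_left fun _ => ?_)
    simp only
    constructor <;> intro he <;> linarith
  · rw [mem_flatHomothetic, ← mem_energyLevel_iff_chart hp hσ y hy]
    exact and_congr_left fun _ => and_iff_left hyN

theorem finrank_eq_one_of_coe_eq (hv₀ : v₀ ≠ 0) {a : ℝ} {K : Submodule ℝ Phase}
    (hK : (K : Set Phase) = {e | v₀ * e.2.1 = a * e.1 ∧ e.2.2 = 0}) :
    Module.finrank ℝ K = 1 := by
  let f : Phase →ₗ[ℝ] ℝ × ℝ × ℝ :=
    { toFun := fun e => (v₀ * e.2.1 - a * e.1, e.2.2)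
      map_add' := fun x y => Prod.ext (by simp; ring) rfl
      map_smul' := fun t x => Prod.ext (by simp; ring) rfl }
  have hf : Function.Surjective f := fun y =>
    ⟨(0, y.1 / v₀, y.2), Prod.ext (by simp [f, mul_div_cancel₀ _ hv₀]) rfl⟩
  have h1 := finrank_ker_phase hf
  have h2 : K = LinearMap.ker f := by
    refine SetLike.coe_injective (hK.trans ?_)
    ext e
    simp [f, sub_eq_zero, Prod.ext_iff]
  rw [h2]
  simp only [Module.finrank_prod, Module.finrank_self] at h1
  omega

/-- The centre manifold is the triple collision manifold near the equilibrium. -/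
theorem Positive.hasCentreManifold (hp : p.Positive) {σ : ℝ} (hσ : σ * σ = 1)
    (hσv : 0 < σ * v₀) (hsq : v₀ ^ 2 = 2 * p.U 0 - C ^ 2) {Ec : Submodule ℝ Phase}
    (hEc : (Ec : Set Phase) = {e | e.1 = 0 ∧ e.2.1 = 0}) :
    HasCentreManifold (p.field h C) domain (p.energyLevel h C ∩ physical) (0, v₀, 0, 0) 2 Ec := by
  have hU0 : 0 < p.U 0 := hp.U_pos (by simp)
  have hv₀ : v₀ ≠ 0 := fun h0 => by simp [h0] at hσv
  have hP : ((0, v₀, 0, 0) : Phase) ∈ domain := zero_mem_Ioo_pi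
  refine ⟨?_, ?_⟩
  · have hE : Ec = flatCollision :=
      SetLike.coe_injective (hEc.trans (ext fun e => (mem_flatCollision e).symm))
    rw [hE, finrank_flatCollision]
  -- a neighbourhood on which the coefficient of `r` in `r'` is bounded
  have hθ : Tendsto (fun x : Phase => x.2.2.1) (𝓝 (0, v₀, 0, 0)) (𝓝 0) :=
    (by fun_prop : Continuous fun x : Phase => x.2.2.1).tendsto' _ _ rfl
  have hA : ContinuousAt (fun θ => Real.cos θ ^ 2 / √(p.U θ)) 0 :=
    (by fun_prop : ContinuousAt (fun θ => Real.cos θ ^ 2) 0).div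
      (hp.hasDerivAt_U zero_mem_Ioo_pi).continuousAt.sqrt (Real.sqrt_pos.2 hU0).ne'
  have hv : Tendsto (fun x : Phase => x.2.1) (𝓝 (0, v₀, 0, 0)) (𝓝 v₀) :=
    (by fun_prop : Continuous fun x : Phase => x.2.1).tendsto' _ _ rfl
  obtain ⟨B, hB⟩ : ∃ B, ∀ᶠ x : Phase in 𝓝 (0, v₀, 0, 0),
      |Real.cos x.2.2.1 ^ 2 / √(p.U x.2.2.1) * x.2.1| < B :=
    ⟨_, ((hA.tendsto.comp hθ).mul hv).abs.eventually (gt_mem_nhds (lt_add_one _))⟩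
  obtain ⟨N, hNsub, hN, hPN⟩ := mem_nhds_iff.1 (inter_mem hB
    ((chart hp h C hσ).open_source.mem_nhds ⟨hP, hσv⟩))
  have hNφ : N ⊆ (chart hp h C hσ).source := hNsub.trans inter_subset_right
  have hE := mem_energyLevel_equilibrium (h := h) hsq
  have hflat : ∀ y ∈ (chart hp h C hσ).source, y ∈ N →
      (y ∈ {x | x ∈ p.energyLevel h C ∩ N ∧ x.1 = 0} ↔
        chart hp h C hσ y ∈ flatCollision) := fun y hy hyN => by
    rw [mem_flatCollision, ← mem_energyLevel_iff_chart hp hσ y hy]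
    exact ⟨fun hy => ⟨hy.2, hy.1.1⟩, fun hy => ⟨⟨hy.2, hyN⟩, hy.1⟩⟩
  refine ⟨N, {x | x ∈ p.energyLevel h C ∩ N ∧ x.1 = 0}, hN, hPN, fun x hx => (hNφ hx).1,
    ⟨⟨hE, hPN⟩, rfl⟩, fun x hx => ⟨⟨hx.1.1, hx.2.ge⟩, hx.1.2⟩, ?_, ?_, ?_⟩
  · exact isSmoothSubmanifold_of_chart (chart hp h C hσ) flatCollision finrank_flatCollision
      (contDiffOn_chart hp hσ) (contDiffOn_chart_symm hp hσ) hN (fun x hx => hNφ hx.1.2)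
      (fun x hx => hx.1.2) hflat
  · have hPS : ((0, v₀, 0, 0) : Phase) ∈ {x | x ∈ p.energyLevel h C ∩ N ∧ x.1 = 0} :=
      ⟨⟨hE, hPN⟩, rfl⟩
    rw [hp.tangentVectors_eq hσ hσv flatCollision hN hPN hPS hflat, hEc]
    ext e
    refine (mem_flatCollision _).trans (and_congr_right fun (he : e.1 = 0) => ?_)
    simp [he, hv₀]
  · intro γ a b ha hb hγ hγN h0 t ht
    refine ⟨⟨hp.isLocallyInvariant_energyLevel γ a b ha hb hγ (fun t ht => (hNφ (hγN t ht)).1)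
      h0.1.1 t ht, hγN t ht⟩, ?_⟩
    refine eq_zero_of_hasDerivAt_mul (r := fun t => (γ t).1) ha hb (fun t ht => ?_)
      (fun t ht => (hNsub (hγN t ht)).1.le) h0.2 t ht
    have h1 : HasDerivAt (fun t => (γ t).1) _ t :=
      ((hγ t ht).hasDerivAt (isOpen_Ioo.mem_nhds ht)).hasFDerivAt.fst.hasDerivAt
    refine h1.congr_deriv ?_
    simp [field]
    ring

theorem Positive.coe_map_line (hp : p.Positive) (hv₀ : v₀ ≠ 0)
    (hsq : v₀ ^ 2 = 2 * p.U 0 - C ^ 2) {K : Submodule ℝ (p.tangentSpace h C (0, v₀, 0, 0))}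
    (hK : ∀ x, x ∈ K ↔ tangentCoord hp h hv₀ hsq x 1 = 0 ∧ tangentCoord hp h hv₀ hsq x 2 = 0) :
    (K.map (p.tangentSpace h C (0, v₀, 0, 0)).subtype : Set Phase) =
      {e | v₀ * e.2.1 = p.V 0 * e.1 ∧ e.2.2 = 0} := by
  ext e
  constructor
  · rintro ⟨x, hx, rfl⟩
    obtain ⟨h1, h2⟩ := (hK x).1 hx
    exact ⟨(hp.mem_tangentSpace hsq _).1 x.2, Prod.ext h1 h2⟩
  · rintro ⟨h1, h2⟩
    exact ⟨⟨e, (hp.mem_tangentSpace hsq _).2 h1⟩,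
      (hK _).2 ⟨congrArg Prod.fst h2, congrArg Prod.snd h2⟩, rfl⟩

theorem Positive.exists_mem_line_fst_pos (hp : p.Positive) (hv₀ : v₀ ≠ 0)
    (hsq : v₀ ^ 2 = 2 * p.U 0 - C ^ 2) {K : Submodule ℝ (p.tangentSpace h C (0, v₀, 0, 0))}
    (hK : ∀ x, x ∈ K ↔ tangentCoord hp h hv₀ hsq x 1 = 0 ∧ tangentCoord hp h hv₀ hsq x 2 = 0) :
    ∃ e ∈ K, 0 < (e : Phase).1 :=
  ⟨(tangentCoord hp h hv₀ hsq).symm ![1, 0, 0], (hK _).2 (by simp), zero_lt_one⟩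

theorem Positive.coe_map_plane (hp : p.Positive) (hv₀ : v₀ ≠ 0)
    (hsq : v₀ ^ 2 = 2 * p.U 0 - C ^ 2) {K : Submodule ℝ (p.tangentSpace h C (0, v₀, 0, 0))}
    (hK : ∀ x, x ∈ K ↔ tangentCoord hp h hv₀ hsq x 0 = 0) :
    (K.map (p.tangentSpace h C (0, v₀, 0, 0)).subtype : Set Phase) =
      {e | e.1 = 0 ∧ e.2.1 = 0} := by
  ext e
  constructor
  · rintro ⟨x, hx, rfl⟩
    have h1 : x.1.1 = 0 := (hK x).1 hx
    have h2 := (hp.mem_tangentSpace hsq _).1 x.2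
    rw [h1, mul_zero] at h2
    exact ⟨h1, (mul_eq_zero.1 h2).resolve_left hv₀⟩
  · rintro ⟨h1, h2⟩
    exact ⟨⟨e, (hp.mem_tangentSpace hsq _).2 (by rw [h1, h2]; ring)⟩, (hK _).2 h1, rfl⟩

theorem Positive.hasUnstableManifold (hp : p.Positive) (h16 : p.γ₀ < 16 * p.γ) (hv₀ : 0 < v₀)
    (hsq : v₀ ^ 2 = 2 * p.U 0 - C ^ 2) {K : Submodule ℝ Phase}
    (hK : (K : Set Phase) = {e | v₀ * e.2.1 = p.V 0 * e.1 ∧ e.2.2 = 0}) :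
    HasUnstableManifold (p.field h C) (p.energyLevel h C) (0, v₀, 0, 0) 1 K := by
  have hσ : (1 : ℝ) * 1 = 1 := by norm_num
  have hσv : 0 < 1 * v₀ := by simpa
  refine ⟨finrank_eq_one_of_coe_eq hv₀.ne' hK, fun O hO => ?_⟩
  obtain ⟨N, hN, hPN, hNO, heq⟩ := hp.exists_localUnstableSet_eq (h := h) h16 hv₀ hsq
    (inter_mem hO ((chart hp h C hσ).open_source.mem_nhds ⟨zero_mem_Ioo_pi, hσv⟩))
  refine ⟨N, hN, hPN, hNO.trans inter_subset_left, ?_⟩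
  rw [heq]
  exact ⟨⟨⟨mem_energyLevel_equilibrium hsq, hPN⟩, rfl⟩,
    isSmoothSubmanifold_homothetic hp hσ hN (hNO.trans inter_subset_right),
    (hp.tangentVectors_homothetic hσ hσv hsq hN hPN).trans hK.symm⟩

theorem Positive.hasStableManifold (hp : p.Positive) (h16 : p.γ₀ < 16 * p.γ) (hv₀ : v₀ < 0)
    (hsq : v₀ ^ 2 = 2 * p.U 0 - C ^ 2) {K : Submodule ℝ Phase}
    (hK : (K : Set Phase) = {e | v₀ * e.2.1 = p.V 0 * e.1 ∧ e.2.2 = 0}) :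
    HasStableManifold (p.field h C) (p.energyLevel h C) (0, v₀, 0, 0) 1 K := by
  have hσ : (-1 : ℝ) * -1 = 1 := by norm_num
  have hσv : 0 < -1 * v₀ := by linarith
  refine ⟨finrank_eq_one_of_coe_eq hv₀.ne hK, fun O hO => ?_⟩
  obtain ⟨N, hN, hPN, hNO, heq⟩ := hp.exists_localStableSet_eq (h := h) h16 hv₀ hsq
    (inter_mem hO ((chart hp h C hσ).open_source.mem_nhds ⟨zero_mem_Ioo_pi, hσv⟩))
  refine ⟨N, hN, hPN, hNO.trans inter_subset_left, ?_⟩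
  rw [heq]
  exact ⟨⟨⟨mem_energyLevel_equilibrium hsq, hPN⟩, rfl⟩,
    isSmoothSubmanifold_homothetic hp hσ hN (hNO.trans inter_subset_right),
    (hp.tangentVectors_homothetic hσ hσv hsq hN hPN).trans hK.symm⟩

end Manev.Params

theorem mainTheorem2 (p : Manev.Params) (hG : 0 < p.G) (hM : 0 < p.M) (hm : 0 < p.m)
    (hγ₀ : 0 < p.γ₀) (hγ : 0 < p.γ) (hγγ₀ : p.γ₀ < 16 * p.γ)
    (h C : ℝ) (hC : |C| < √(2 * p.U 0)) :
    (p.IsRegularCollisionEquilibrium h C (p.Pplus C) ∧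
      ∃ hJ : ∀ x ∈ p.tangentSpace h C (p.Pplus C),
          p.linearization h C (p.Pplus C) x ∈ p.tangentSpace h C (p.Pplus C),
        let T := p.tangentSpace h C (p.Pplus C)
        let J : Module.End ℝ T := (p.linearization h C (p.Pplus C)).restrict hJ
        (∃ l b : ℝ, 0 < l ∧ 0 < b ∧
          J.charpoly = (Polynomial.X - Polynomial.C l) *
            (Polynomial.X ^ 2 + Polynomial.C (b ^ 2))) ∧
        stableSubspace J = ⊥ ∧
        HasUnstableManifold (p.field h C) (p.energyLevel h C) (p.Pplus C) 1
          ((unstableSubspace J).map T.subtype) ∧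
        (∃ e ∈ unstableSubspace J, 0 < (e : Manev.Phase).1) ∧
        HasCentreManifold (p.field h C) Manev.domain (p.energyLevel h C ∩ Manev.physical)
          (p.Pplus C) 2 ((centreSubspace J).map T.subtype)) ∧
    (p.IsRegularCollisionEquilibrium h C (p.Pminus C) ∧
      ∃ hJ : ∀ x ∈ p.tangentSpace h C (p.Pminus C),
          p.linearization h C (p.Pminus C) x ∈ p.tangentSpace h C (p.Pminus C),
        let T := p.tangentSpace h C (p.Pminus C)
        let J : Module.End ℝ T := (p.linearization h C (p.Pminus C)).restrict hJ
        (∃ l b : ℝ, l < 0 ∧ 0 < b ∧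
          J.charpoly = (Polynomial.X - Polynomial.C l) *
            (Polynomial.X ^ 2 + Polynomial.C (b ^ 2))) ∧
        unstableSubspace J = ⊥ ∧
        HasStableManifold (p.field h C) (p.energyLevel h C) (p.Pminus C) 1
          ((stableSubspace J).map T.subtype) ∧
        (∃ e ∈ stableSubspace J, 0 < (e : Manev.Phase).1) ∧
        HasCentreManifold (p.field h C) Manev.domain (p.energyLevel h C ∩ Manev.physical)
          (p.Pminus C) 2 ((centreSubspace J).map T.subtype)) := by
  have hp : p.Positive := ⟨hG, hM, hm, hγ₀, hγ⟩
  have hU0 : 0 < p.U 0 := hp.U_pos (by simp)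
  have hC2 : 0 < 2 * p.U 0 - C ^ 2 := by
    have := Real.lt_sqrt (abs_nonneg C) |>.1 hC
    rw [sq_abs] at this
    linarith
  have hb : 0 < √(p.freqSq C) := Real.sqrt_pos.2 (hp.freqSq_pos hγγ₀ C)
  have hv : 0 < √(2 * p.U 0 - C ^ 2) := Real.sqrt_pos.2 hC2
  have hsq : √(2 * p.U 0 - C ^ 2) ^ 2 = 2 * p.U 0 - C ^ 2 := Real.sq_sqrt hC2.le
  have hsq' : (-√(2 * p.U 0 - C ^ 2)) ^ 2 = 2 * p.U 0 - C ^ 2 := by rw [neg_sq, hsq]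
  unfold Manev.Params.Pplus Manev.Params.Pminus
  generalize √(2 * p.U 0 - C ^ 2) = v at hv hsq hsq'
  have hl : 0 < v / √(p.U 0) := by positivity
  have hl' : -v / √(p.U 0) < 0 := by rw [neg_div]; linarith
  constructor
  · refine ⟨hp.isRegularCollisionEquilibrium (σ := 1) (by norm_num) (by simpa) hsq,
      hp.linearization_mem hsq, ?_⟩
    have hA := hp.tangentCoord_restrict hγγ₀ hv.ne' hsq (hp.linearization_mem (h := h) hsq)
    have hline := mem_spectralSubspace_line (Z := {z | 0 < z.re}) hb.ne' hA (by simpa using hl)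
      (fun z (hz : 0 < z.re) => hz.ne')
    refine ⟨⟨_, _, hl, hb, charpoly_of_line_plus_rotation _ _ hA⟩,
      spectralSubspace_eq_bot hb.ne' hA (fun z (hz : z.re < 0) => (hz.trans hl).ne)
        (fun z (hz : z.re < 0) => hz.ne),
      hp.hasUnstableManifold hγγ₀ hv hsq (hp.coe_map_line hv.ne' hsq hline),
      hp.exists_mem_line_fst_pos hv.ne' hsq hline,
      hp.hasCentreManifold (σ := 1) (by norm_num) (by simpa) hsq
        (hp.coe_map_plane hv.ne' hsq (mem_centreSubspace_plane hl.ne' hA))⟩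
  · have hv' : -v < 0 := by linarith
    refine ⟨hp.isRegularCollisionEquilibrium (σ := -1) (by norm_num) (by simpa) hsq',
      hp.linearization_mem hsq', ?_⟩
    have hA := hp.tangentCoord_restrict hγγ₀ hv'.ne hsq' (hp.linearization_mem (h := h) hsq')
    have hline := mem_spectralSubspace_line (Z := {z | z.re < 0}) hb.ne' hA (by simpa using hl')
      (fun z (hz : z.re < 0) => hz.ne)
    refine ⟨⟨_, _, hl', hb, charpoly_of_line_plus_rotation _ _ hA⟩,
      spectralSubspace_eq_bot hb.ne' hA (fun z (hz : 0 < z.re) => (hl'.trans hz).ne')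
        (fun z (hz : 0 < z.re) => hz.ne'),
      hp.hasStableManifold hγγ₀ hv' hsq' (hp.coe_map_line hv'.ne hsq' hline),
      hp.exists_mem_line_fst_pos hv'.ne hsq' hline,
      hp.hasCentreManifold (σ := -1) (by norm_num) (by simpa) hsq'
        (hp.coe_map_plane hv'.ne hsq' (mem_centreSubspace_plane hl'.ne hA))⟩
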